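/- **Setting.** Let $\sigma:\mathbb R\to\mathbb R$ be Lipschitz, and fix constants $c,a>0$ and $C,b,s$. For $n,m,d\ge 1$ let $W\in\mathbb R^{m\times d}$ have i.i.d. $\mathcal N(0,1)$ entries, and let $\varphi(x)=\frac1{\sqrt m}\,\sigma(Wx/\sqrt d)\in\mathbb R^m$ ($\sigma$ applied entrywise). Let $\rho$ be a Borel probability measure on $\mathbb R^d\times\mathbb R$ with $\mathbb E\,y^2<\infty$, and put $\Sigma_d=\mathbb E_x[x\otimes x]$, $\Sigma_m=\mathbb E_x[\varphi(x)\otimes\varphi(x)]$ and $\widetilde\Sigma_m=\mathbb E_W[\Sigma_m]$. For each $W$ let $f^*=\langle\theta^*,\varphi(\cdot)\rangle$ minimize $\mathbb E_\rho(f(x)-y)^2$ over all $f=\langle\theta,\varphi(\cdot)\rangle$, $\theta\in\mathbb R^m$, and put $\varepsilon=y-f^*(x)$. The samples $(x_t,y_t)_{t\ge1}$ are i.i.d. from $\rho$ and independent of $W$, and $\varepsilon_t=y_t-f^*(x_t)$. With $\gamma_t=\gamma_0t^{-\zeta}$ define $$\eta_0=0,\qquad \eta_t=[I-\gamma_t\varphi(x_t)\otimes\varphi(x_t)]\,\eta_{t-1}+\gamma_t\varepsilon_t\varphi(x_t),\qquad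 \bar\eta_n=\frac1n\sum_{t=0}^{n-1}\eta_t,\qquad \mathtt{Variance}=\mathbb E\,\langle\bar\eta_n,\Sigma_m\bar\eta_n\rangle,$$ where the last expectation is over $W$ and the samples. **Theorem (error bound for the variance).** There are constants $c_0,C_0>0$, depending only on $\sigma,c,C,a,b,s$, such that the following holds for all $\zeta\in[0,1)$, all $n,m,d$ with $c\le d/n\le C$ and $c\le m/n\le C$, all $\rho$, all $r',r\ge1$, $\tau>0$ and $\gamma_0>0$. Assume: 1. $\|x\|_2^2\le b\,d$ almost surely, $\mathbb E\|x\|_2^2=\mathrm{Tr}(\Sigma_d)\ge a\,d$, and $\|\Sigma_d\|_2\le s$; 2. (fourth moment condition) for every PSD matrix $A\in\mathbb R^{m\times m}$, $$\mathbb E_W[\Sigma_mA\Sigma_m]\preccurlyeq\mathbb E_W\mathbb E_x\big[(\varphi(x)\otimes\varphi(x))A(\varphi(x)\otimes\varphi(x))\big]\preccurlyeq r'\,\mathbb E_W[\mathrm{Tr}(\Sigma_mA)\Sigma_m]\preccurlyeq r\,\mathrm{Tr}(\widetilde\Sigma_mA)\widetilde\Sigma_m;$$ 3. (noise condition) $\mathbb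 E_{(x,y)\sim\rho}[\varepsilon^2\varphi(x)\otimes\varphi(x)]\preccurlyeq\tau^2\Sigma_m$ for almost every $W$; 4. $\gamma_0\,r'\,\mathrm{Tr}(\widetilde\Sigma_m)\le c_0$. Then $$\mathtt{Variance}\le C_0\,\gamma_0\,r'\,\tau^2\cdot\begin{cases}m\,n^{\zeta-1}&\text{if }m\le n,\\ 1+n^{\zeta-1}+\dfrac nm&\text{if }m>n.\end{cases}$$ Moreover, for fixed $n\geq 1$ and $\zeta\in[0,1)$, the case expression on the right is strictly increasing in $m$ for $m\le n$ and strictly decreasing in $m$ for $m>n$ (so it is unimodal in $m$). -/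

import Mathlib

open MeasureTheory ProbabilityTheory
open scoped NNReal ENNReal Matrix

noncomputable section

namespace RFSGD

/-- The law of the `m × d` matrix `W` whose entries are i.i.d. standard Gaussian. -/
def weightLaw (m d : ℕ) : Measure (Fin m → Fin d → ℝ) :=
  Measure.pi fun _ => Measure.pi fun _ => gaussianReal 0 1

/-- The random feature map `φ(x) = σ(W x / √d) / √m`, with `σ` applied entrywise. -/
def feature (σ : ℝ → ℝ) {m d : ℕ} (W : Fin m → Fin d → ℝ) (x : EuclideanSpace ℝ (Fin d)) :
    Fin m → ℝ :=
  fun i => σ ((∑ j, W i j * x j) / √(d : ℝ)) / √(m : ℝ)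

/-- `φ(x) ⊗ φ(x)` as an `m × m` matrix. -/
def featureOuter (σ : ℝ → ℝ) {m d : ℕ} (W : Fin m → Fin d → ℝ) (x : EuclideanSpace ℝ (Fin d)) :
    Matrix (Fin m) (Fin m) ℝ :=
  Matrix.vecMulVec (feature σ W x) (feature σ W x)

/-- Entrywise expectation of a random matrix. -/
def matrixExp {Ω : Type*} [MeasurableSpace Ω] (μ : Measure Ω) {m : ℕ}
    (F : Ω → Matrix (Fin m) (Fin m) ℝ) : Matrix (Fin m) (Fin m) ℝ :=
  Matrix.of fun i j => ∫ ω, F ω i j ∂μ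

/-- The Loewner order `A ≼ B`. -/
def Loewner {m : ℕ} (A B : Matrix (Fin m) (Fin m) ℝ) : Prop := (B - A).PosSemidef

/-- The data covariance `Σ_d = E[x ⊗ x]`. -/
def dataCov {d : ℕ} (ρ : Measure (EuclideanSpace ℝ (Fin d) × ℝ)) : Matrix (Fin d) (Fin d) ℝ :=
  matrixExp ρ fun p => Matrix.vecMulVec (fun i => p.1 i) (fun i => p.1 i)

/-- The feature covariance `Σ_m = E_x[φ(x) ⊗ φ(x)]`, which depends on `W`. -/
def featureCov (σ : ℝ → ℝ) {m d : ℕ} (ρ : Measure (EuclideanSpace ℝ (Fin d) × ℝ))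
    (W : Fin m → Fin d → ℝ) : Matrix (Fin m) (Fin m) ℝ :=
  matrixExp ρ fun p => featureOuter σ W p.1

/-- The expected feature covariance `E_W[Σ_m]`. -/
def meanFeatureCov (σ : ℝ → ℝ) (m : ℕ) {d : ℕ} (ρ : Measure (EuclideanSpace ℝ (Fin d) × ℝ)) :
    Matrix (Fin m) (Fin m) ℝ :=
  matrixExp (weightLaw m d) fun W => featureCov σ ρ W

/-- The high-dimensional regime: `n`, `m`, `d` are comparable. -/
structure Comparable (c C : ℝ) (n m d : ℕ) : Prop where
  n_pos : 0 < n
  d_lower : c ≤ (d : ℝ) / n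
  d_upper : (d : ℝ) / n ≤ C
  m_lower : c ≤ (m : ℝ) / n
  m_upper : (m : ℝ) / n ≤ C

/-- The conditions on the data: `‖x‖²` is of order `d` (it is at most `b d` almost surely, and at
least `a d` on average), `Σ_d` has spectral norm at most `s`, and `y` is square integrable. -/
structure DataCondition (a b s : ℝ) {d : ℕ} (ρ : Measure (EuclideanSpace ℝ (Fin d) × ℝ)) :
    Prop where
  norm_upper : ∀ᵐ p ∂ρ, ‖p.1‖ ^ 2 ≤ b * d
  norm_lower : a * d ≤ (dataCov ρ).trace
  spectral : ‖Matrix.toEuclideanCLM (n := Fin d) (𝕜 := ℝ) (dataCov ρ)‖ ≤ s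
  label : MemLp (fun p : EuclideanSpace ℝ (Fin d) × ℝ => p.2) 2 ρ

/-- The fourth moment condition with constants `r'` and `r`. -/
structure FourthMoment (σ : ℝ → ℝ) (m : ℕ) {d : ℕ}
    (ρ : Measure (EuclideanSpace ℝ (Fin d) × ℝ)) (r' r : ℝ) : Prop where
  lower : ∀ A : Matrix (Fin m) (Fin m) ℝ, A.PosSemidef →
    Loewner
      (matrixExp (weightLaw m d) fun W => featureCov σ ρ W * A * featureCov σ ρ W)
      (matrixExp (weightLaw m d) fun W =>
        matrixExp ρ fun p => featureOuter σ W p.1 * A * featureOuter σ W p.1)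
  middle : ∀ A : Matrix (Fin m) (Fin m) ℝ, A.PosSemidef →
    Loewner
      (matrixExp (weightLaw m d) fun W =>
        matrixExp ρ fun p => featureOuter σ W p.1 * A * featureOuter σ W p.1)
      (r' • matrixExp (weightLaw m d) fun W =>
        (featureCov σ ρ W * A).trace • featureCov σ ρ W)
  upper : ∀ A : Matrix (Fin m) (Fin m) ℝ, A.PosSemidef →
    Loewner
      (r' • matrixExp (weightLaw m d) fun W =>
        (featureCov σ ρ W * A).trace • featureCov σ ρ W)
      ((r * (meanFeatureCov σ m ρ * A).trace) • meanFeatureCov σ m ρ)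

/-- The expected squared loss of `x ↦ ⟨θ, φ(x)⟩`. -/
def risk (σ : ℝ → ℝ) {m d : ℕ} (ρ : Measure (EuclideanSpace ℝ (Fin d) × ℝ))
    (W : Fin m → Fin d → ℝ) (θ : Fin m → ℝ) : ℝ :=
  ∫ p, (θ ⬝ᵥ feature σ W p.1 - p.2) ^ 2 ∂ρ

/-- `θ W` represents the best predictor `f⋆ = ⟨θ W, φ(·)⟩` in the hypothesis space given by `W`.
(If there are several minimizers, they give the same `f⋆` almost everywhere.) -/
structure IsTarget (σ : ℝ → ℝ) {m d : ℕ} (ρ : Measure (EuclideanSpace ℝ (Fin d) × ℝ))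
    (θ : (Fin m → Fin d → ℝ) → Fin m → ℝ) : Prop where
  measurable : Measurable θ
  minimizes : ∀ W, IsMinOn (risk σ ρ W) Set.univ (θ W)

/-- The noise `ε = y - f⋆(x)`. -/
def noise (σ : ℝ → ℝ) {m d : ℕ} (θ : (Fin m → Fin d → ℝ) → Fin m → ℝ)
    (W : Fin m → Fin d → ℝ) (p : EuclideanSpace ℝ (Fin d) × ℝ) : ℝ :=
  p.2 - θ W ⬝ᵥ feature σ W p.1

/-- The noise condition `Ξ = E[ε² φ(x) ⊗ φ(x)] ≼ τ² Σ_m`, for almost every `W`. -/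
def NoiseCondition (σ : ℝ → ℝ) {m d : ℕ} (ρ : Measure (EuclideanSpace ℝ (Fin d) × ℝ))
    (θ : (Fin m → Fin d → ℝ) → Fin m → ℝ) (τ : ℝ) : Prop :=
  ∀ᵐ W ∂(weightLaw m d),
    Loewner (matrixExp ρ fun p => noise σ θ W p ^ 2 • featureOuter σ W p.1)
      (τ ^ 2 • featureCov σ ρ W)

/-- The step size `γ_t = γ₀ t^{-ζ}`, for `t ≥ 1`. -/
def stepSize (γ₀ ζ : ℝ) (t : ℕ) : ℝ := γ₀ * (t : ℝ) ^ (-ζ)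

/-- The variance iterates `η_t = (I - γ_t φ(x_t) ⊗ φ(x_t)) η_{t-1} + γ_t ε_t φ(x_t)`, `η_0 = 0`,
along the sample sequence `z t = (x_t, y_t)`, `t ≥ 1`. -/
def varIterate (σ : ℝ → ℝ) {m d : ℕ} (θ : (Fin m → Fin d → ℝ) → Fin m → ℝ) (γ₀ ζ : ℝ)
    (W : Fin m → Fin d → ℝ) (z : ℕ → EuclideanSpace ℝ (Fin d) × ℝ) : ℕ → Fin m → ℝ
  | 0 => 0
  | t + 1 =>
    (1 - stepSize γ₀ ζ (t + 1) • featureOuter σ W (z (t + 1)).1) *ᵥ varIterate σ θ γ₀ ζ W z t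
      + (stepSize γ₀ ζ (t + 1) * noise σ θ W (z (t + 1))) • feature σ W (z (t + 1)).1

/-- The average of the first `n` variance iterates `η_0, …, η_{n-1}`. -/
def varAverage (σ : ℝ → ℝ) {m d : ℕ} (θ : (Fin m → Fin d → ℝ) → Fin m → ℝ) (γ₀ ζ : ℝ) (n : ℕ)
    (W : Fin m → Fin d → ℝ) (z : ℕ → EuclideanSpace ℝ (Fin d) × ℝ) : Fin m → ℝ :=
  (1 / (n : ℝ)) • ∑ t ∈ Finset.range n, varIterate σ θ γ₀ ζ W z t

/-- The variance term: the expectation of the nonnegative quantity `⟨η̄_n, Σ_m η̄_n⟩` over `W` and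
over the i.i.d. samples `(x_t, y_t) ∼ ρ`, which are independent of `W`; a priori in `[0, ∞]`. -/
def variance (σ : ℝ → ℝ) {m d : ℕ} (ρ : Measure (EuclideanSpace ℝ (Fin d) × ℝ))
    [IsProbabilityMeasure ρ] (θ : (Fin m → Fin d → ℝ) → Fin m → ℝ) (γ₀ ζ : ℝ) (n : ℕ) : ℝ≥0∞ :=
  ∫⁻ W, ∫⁻ z, ENNReal.ofReal
      (varAverage σ θ γ₀ ζ n W z ⬝ᵥ (featureCov σ ρ W *ᵥ varAverage σ θ γ₀ ζ n W z))
    ∂(Measure.infinitePi fun _ : ℕ => ρ) ∂(weightLaw m d)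

/-- The dependence of the variance bound on `n` and `m`. -/
def varianceRate (ζ : ℝ) (n m : ℕ) : ℝ :=
  if m ≤ n then (m : ℝ) * (n : ℝ) ^ (ζ - 1) else 1 + (n : ℝ) ^ (ζ - 1) + (n : ℝ) / m

end RFSGD

end

/-! In the comparable regime the rate is bounded below by `min c 1` (`le_varianceRate`), so it
suffices to bound the variance by a constant times `γ₀ τ²`.

Fix `W`. The features satisfy `‖φ(x)‖² ≤ R` with `R = A + D ‖W‖² / m`, because `σ` is Lipschitz and
`‖x‖²` is at most of order `d`. The first order condition for `f⋆` makes the noise uncorrelated with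
the features, so the iterates stay centered and their covariance obeys a recursion
(`MomentBound.step`). If `γ₀ R ≤ 1`, the bound `γ₀ τ² I` reproduces itself under the recursion, and
convexity gives a conditional variance of at most `γ₀ τ² R`. If `γ₀ R > 1`, stability may fail, but
over `n` steps the covariance grows at most by the factor `exp (2 n γ₀ R)`.

It remains to integrate over `W`. Since `E exp (‖W‖² / 256) ≤ 8 ^ d * 2 ^ m`
(`lintegral_exp_norm_weightOp`) and `n`, `m`, `d` are comparable, `R` has exponential moments at
scale `1 / n`: `E exp (n (lam R - M)) ≤ 1` for constants `lam`, `M` (`lintegral_exp_le_one`). This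
absorbs the exponential growth as soon as `γ₀` is below a constant (`mul_ite_exp_le`).

That smallness follows from the step size condition, because the trace of the expected feature
covariance is bounded below unless `σ = 0` (`le_trace_meanFeatureCov`); for `σ = 0` the variance
vanishes. -/

open MeasureTheory ProbabilityTheory
open scoped NNReal ENNReal Matrix

noncomputable section

namespace RFSGD

/-! ### Covariance in one step of stochastic gradient descent -/

/-- The random vector with law `μ` is centered and square integrable, and its covariance is at most
`α • 1` in the Loewner order. -/
structure MomentBound {m : ℕ} (μ : Measure (Fin m → ℝ)) (α : ℝ) : Prop where
  memLp : ∀ i, MemLp (fun η : Fin m → ℝ => η i) 2 μ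
  mean : ∀ v : Fin m → ℝ, ∫ η, v ⬝ᵥ η ∂μ = 0
  second : ∀ v : Fin m → ℝ, ∫ η, (v ⬝ᵥ η) ^ 2 ∂μ ≤ α * (v ⬝ᵥ v)

/-- A linear regression model with features `u` and centered noise `e`: the squared length of the
features is at most `R`, and the noise covariance is at most `τ²` times the feature covariance. -/
structure NoiseModel {m : ℕ} {X : Type*} [MeasurableSpace X] (ρ : Measure X)
    (u : X → Fin m → ℝ) (e : X → ℝ) (R τ : ℝ) : Prop where
  measurable_u : Measurable u
  measurable_e : Measurable e
  bound : ∀ᵐ p ∂ρ, u p ⬝ᵥ u p ≤ R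
  memLp : MemLp e 2 ρ
  mean : ∀ v : Fin m → ℝ, ∫ p, e p * (v ⬝ᵥ u p) ∂ρ = 0
  second : ∀ v : Fin m → ℝ, ∫ p, e p ^ 2 * (v ⬝ᵥ u p) ^ 2 ∂ρ ≤ τ ^ 2 * ∫ p, (v ⬝ᵥ u p) ^ 2 ∂ρ

section Vectors

variable {m : ℕ}

theorem memLp_dotProduct {X : Type*} [MeasurableSpace X] {ρ : Measure X} {q : ℝ≥0∞}
    {u : X → Fin m → ℝ} (hu : ∀ i, MemLp (fun p => u p i) q ρ) (v : Fin m → ℝ) :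
    MemLp (fun p => v ⬝ᵥ u p) q ρ := by
  simp only [dotProduct]
  exact memLp_finsetSum _ fun i _ => (hu i).const_mul (v i)

theorem dotProduct_sq_le (v w : Fin m → ℝ) : (v ⬝ᵥ w) ^ 2 ≤ (v ⬝ᵥ v) * (w ⬝ᵥ w) := by
  simp only [dotProduct, ← pow_two]
  exact Finset.sum_mul_sq_le_sq_mul_sq _ _ _

theorem sq_apply_le_dotProduct_self (v : Fin m → ℝ) (i : Fin m) : v i ^ 2 ≤ v ⬝ᵥ v := by
  simp only [dotProduct, ← pow_two]
  exact Finset.single_le_sum (f := fun i => v i ^ 2) (fun i _ => sq_nonneg _) (Finset.mem_univ i)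

theorem dotProduct_self_nonneg' (v : Fin m → ℝ) : 0 ≤ v ⬝ᵥ v :=
  Finset.sum_nonneg fun _ _ => mul_self_nonneg _

theorem measurable_dotProduct' {X : Type*} [MeasurableSpace X] {u w : X → Fin m → ℝ}
    (hu : Measurable u) (hw : Measurable w) : Measurable fun p => u p ⬝ᵥ w p := by
  simp only [dotProduct]
  exact Finset.measurable_sum _ fun i _ =>
    ((measurable_pi_apply i).comp hu).mul ((measurable_pi_apply i).comp hw)

end Vectors

namespace NoiseModel

variable {m : ℕ} {X : Type*} [MeasurableSpace X] {ρ : Measure X}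
  {u : X → Fin m → ℝ} {e : X → ℝ} {R τ : ℝ}

theorem memLp_top (h : NoiseModel ρ u e R τ) (i : Fin m) : MemLp (fun p => u p i) ∞ ρ := by
  refine memLp_top_of_bound ((measurable_pi_apply i).comp h.measurable_u).aestronglyMeasurable
    (√R) ?_
  filter_upwards [h.bound] with p hp
  exact Real.abs_le_sqrt ((sq_apply_le_dotProduct_self _ i).trans hp)

theorem memLp_top_dotProduct (h : NoiseModel ρ u e R τ) (v : Fin m → ℝ) :
    MemLp (fun p => v ⬝ᵥ u p) ∞ ρ :=
  memLp_dotProduct h.memLp_top v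

theorem memLp_noise_mul (h : NoiseModel ρ u e R τ) (v : Fin m → ℝ) :
    MemLp (fun p => e p * (v ⬝ᵥ u p)) 2 ρ :=
  (h.memLp_top_dotProduct v).mul (p := 2) (q := ∞) (r := 2) h.memLp

variable [IsProbabilityMeasure ρ]

theorem nonneg (h : NoiseModel ρ u e R τ) : 0 ≤ R := by
  obtain ⟨p, hp⟩ := h.bound.exists
  exact (dotProduct_self_nonneg' _).trans hp

theorem integrable_sq_dotProduct (h : NoiseModel ρ u e R τ) (v : Fin m → ℝ) :
    Integrable (fun p => (v ⬝ᵥ u p) ^ 2) ρ :=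
  ((h.memLp_top_dotProduct v).mono_exponent le_top).integrable_sq

theorem integral_sq_dotProduct_le (h : NoiseModel ρ u e R τ) (v : Fin m → ℝ) :
    ∫ p, (v ⬝ᵥ u p) ^ 2 ∂ρ ≤ R * (v ⬝ᵥ v) := by
  have : ∫ p, (v ⬝ᵥ u p) ^ 2 ∂ρ ≤ ∫ _, R * (v ⬝ᵥ v) ∂ρ := by
    refine integral_mono_ae (h.integrable_sq_dotProduct v) (integrable_const _) ?_
    filter_upwards [h.bound] with p hp
    refine (dotProduct_sq_le _ _).trans ?_
    rw [mul_comm]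
    exact mul_le_mul_of_nonneg_right hp (dotProduct_self_nonneg' _)
  simpa using this

end NoiseModel

/-- One step of stochastic gradient descent with step size `γ`, from the point `η`. -/
def sgdStep {m : ℕ} {X : Type*} (u : X → Fin m → ℝ) (e : X → ℝ) (γ : ℝ)
    (q : (Fin m → ℝ) × X) : Fin m → ℝ :=
  q.1 + (γ * (e q.2 - u q.2 ⬝ᵥ q.1)) • u q.2

/-- Transposing the rank-one update onto the test vector leaves an affine function of `η` for each
fixed sample, so the cross term disappears when `η` is centered. -/
theorem dotProduct_sgdStep {m : ℕ} {X : Type*} (u : X → Fin m → ℝ) (e : X → ℝ) (γ : ℝ)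
    (v η : Fin m → ℝ) (p : X) :
    v ⬝ᵥ sgdStep u e γ (η, p)
      = (v - (γ * (v ⬝ᵥ u p)) • u p) ⬝ᵥ η + γ * (e p * (v ⬝ᵥ u p)) := by
  simp only [sgdStep, dotProduct_add, dotProduct_smul, sub_dotProduct, smul_dotProduct, smul_eq_mul]
  ring

section Step

variable {m : ℕ} {X : Type*} [MeasurableSpace X] {ρ : Measure X} [IsProbabilityMeasure ρ]
  {u : X → Fin m → ℝ} {e : X → ℝ} {R τ : ℝ}

theorem measurable_sgdStep (hu : Measurable u) (he : Measurable e) (γ : ℝ) :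
    Measurable (sgdStep u e γ) := by
  unfold sgdStep
  have h1 : Measurable fun q : (Fin m → ℝ) × X => u q.2 := hu.comp measurable_snd
  exact measurable_fst.add (((he.comp measurable_snd).sub
    (measurable_dotProduct' h1 measurable_fst)).const_mul γ |>.smul h1)

/-- The covariance bound after one step of stochastic gradient descent. -/
theorem MomentBound.step {μ : Measure (Fin m → ℝ)} [IsProbabilityMeasure μ] {α β γ : ℝ}
    (hμ : MomentBound μ α) (h : NoiseModel ρ u e R τ) (hα : 0 ≤ α)
    (hβ : ∀ q S : ℝ, 0 ≤ S → S ≤ R * q →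
      α * q + (γ ^ 2 * τ ^ 2 - α * (γ * 2 - γ ^ 2 * R)) * S ≤ β * q) :
    MomentBound ((μ.prod ρ).map (sgdStep u e γ)) β := by
  have hm := measurable_sgdStep h.measurable_u h.measurable_e γ
  have hlin : ∀ w : Fin m → ℝ, MemLp (fun η => w ⬝ᵥ η) 2 μ := memLp_dotProduct hμ.memLp
  -- square integrability
  have hcoord : ∀ i, MemLp (fun q : (Fin m → ℝ) × X => sgdStep u e γ q i) 2 (μ.prod ρ) := by
    intro i
    have h1 : MemLp (fun q : (Fin m → ℝ) × X => q.1 i) 2 (μ.prod ρ) := (hμ.memLp i).comp_fst ρ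
    have h2 : ∀ j, MemLp (fun q : (Fin m → ℝ) × X => u q.2 j) ∞ (μ.prod ρ) :=
      fun j => (h.memLp_top j).comp_snd μ
    have h3 : MemLp (fun q : (Fin m → ℝ) × X => u q.2 ⬝ᵥ q.1) 2 (μ.prod ρ) := by
      simp only [dotProduct]
      refine memLp_finsetSum _ fun j _ => ?_
      exact ((hμ.memLp j).comp_fst ρ).mul (p := ∞) (q := 2) (r := 2) (h2 j)
    have h4 : MemLp (fun q : (Fin m → ℝ) × X => γ * (e q.2 - u q.2 ⬝ᵥ q.1)) 2 (μ.prod ρ) :=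
      ((h.memLp.comp_snd μ).sub h3).const_mul γ
    exact h1.add ((h2 i).mul (p := 2) (q := ∞) (r := 2) h4)
  have hdot : ∀ v : Fin m → ℝ, MemLp (fun q => v ⬝ᵥ sgdStep u e γ q) 2 (μ.prod ρ) :=
    memLp_dotProduct hcoord
  have hmeas : ∀ v : Fin m → ℝ, Measurable fun η : Fin m → ℝ => v ⬝ᵥ η := fun v =>
    measurable_dotProduct' measurable_const measurable_id
  refine ⟨fun i => ?_, fun v => ?_, fun v => ?_⟩
  · rw [memLp_map_measure_iff (measurable_pi_apply i).aestronglyMeasurable hm.aemeasurable]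
    exact hcoord i
  · rw [integral_map hm.aemeasurable (hmeas v).aestronglyMeasurable,
      integral_prod_symm _ ((hdot v).integrable one_le_two)]
    have : ∀ p, ∫ η, v ⬝ᵥ sgdStep u e γ (η, p) ∂μ = γ * (e p * (v ⬝ᵥ u p)) := by
      intro p
      simp_rw [dotProduct_sgdStep]
      rw [integral_add ((hlin _).integrable one_le_two) (integrable_const _), hμ.mean]
      simp
    simp_rw [this]
    rw [integral_const_mul, h.mean, mul_zero]
  · have hsq : Integrable (fun q => (v ⬝ᵥ sgdStep u e γ q) ^ 2) (μ.prod ρ) := (hdot v).integrable_sq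
    rw [integral_map hm.aemeasurable ((hmeas v).pow_const 2).aestronglyMeasurable,
      integral_prod_symm _ hsq]
    -- The sample `p` is held fixed and `η` is integrated first. Centering kills the cross term, and
    -- the covariance bound is applied to the contracted test vector `w`, where `u p ⬝ᵥ u p ≤ R`
    -- controls the quadratic term in `γ`.
    have hinner : ∀ᵐ p ∂ρ, ∫ η, (v ⬝ᵥ sgdStep u e γ (η, p)) ^ 2 ∂μ
        ≤ α * (v ⬝ᵥ v) - α * (γ * 2 - γ ^ 2 * R) * (v ⬝ᵥ u p) ^ 2
          + γ ^ 2 * (e p ^ 2 * (v ⬝ᵥ u p) ^ 2) := by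
      filter_upwards [h.bound] with p hp
      set w := v - (γ * (v ⬝ᵥ u p)) • u p with hw
      set k := γ * (e p * (v ⬝ᵥ u p)) with hk
      have e1 : ∫ η, (v ⬝ᵥ sgdStep u e γ (η, p)) ^ 2 ∂μ = ∫ η, (w ⬝ᵥ η) ^ 2 ∂μ + k ^ 2 := by
        have : ∀ η, (v ⬝ᵥ sgdStep u e γ (η, p)) ^ 2
            = (w ⬝ᵥ η) ^ 2 + (2 * k) * (w ⬝ᵥ η) + k ^ 2 := by
          intro η
          rw [dotProduct_sgdStep]
          ring
        simp_rw [this]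
        have i1 : Integrable (fun η => (w ⬝ᵥ η) ^ 2) μ := (hlin w).integrable_sq
        have i2 : Integrable (fun η => (2 * k) * (w ⬝ᵥ η)) μ :=
          ((hlin w).integrable one_le_two).const_mul _
        have i12 : Integrable (fun η => (w ⬝ᵥ η) ^ 2 + (2 * k) * (w ⬝ᵥ η)) μ := i1.add i2
        rw [integral_add i12 (integrable_const _), integral_add i1 i2, integral_const_mul,
          hμ.mean]
        simp
      have e2 : w ⬝ᵥ w = v ⬝ᵥ v - 2 * γ * (v ⬝ᵥ u p) ^ 2
          + γ ^ 2 * (v ⬝ᵥ u p) ^ 2 * (u p ⬝ᵥ u p) := by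
        simp only [hw, dotProduct_sub, sub_dotProduct, dotProduct_smul, smul_dotProduct,
          smul_eq_mul, dotProduct_comm (u p) v]
        ring
      have e3 : w ⬝ᵥ w ≤ v ⬝ᵥ v - (γ * 2 - γ ^ 2 * R) * (v ⬝ᵥ u p) ^ 2 := by
        rw [e2]
        have := mul_le_mul_of_nonneg_left hp
          (mul_nonneg (sq_nonneg γ) (sq_nonneg (v ⬝ᵥ u p)))
        linarith
      rw [e1]
      have := (hμ.second w).trans (mul_le_mul_of_nonneg_left e3 hα)
      have e4 : k ^ 2 = γ ^ 2 * (e p ^ 2 * (v ⬝ᵥ u p) ^ 2) := by rw [hk]; ring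
      rw [e4]
      linarith
    have i1 := h.integrable_sq_dotProduct v
    have i2 : Integrable (fun p => e p ^ 2 * (v ⬝ᵥ u p) ^ 2) ρ := by
      simpa only [mul_pow] using (h.memLp_noise_mul v).integrable_sq
    have i3 := (i1.const_mul (α * (γ * 2 - γ ^ 2 * R)))
    refine (integral_mono_ae hsq.integral_prod_right
      (((integrable_const _).sub i3).add (i2.const_mul (γ ^ 2))) hinner).trans ?_
    have e5 : ∫ p, (α * (v ⬝ᵥ v) - α * (γ * 2 - γ ^ 2 * R) * (v ⬝ᵥ u p) ^ 2
          + γ ^ 2 * (e p ^ 2 * (v ⬝ᵥ u p) ^ 2)) ∂ρ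
        = α * (v ⬝ᵥ v) - α * (γ * 2 - γ ^ 2 * R) * ∫ p, (v ⬝ᵥ u p) ^ 2 ∂ρ
          + γ ^ 2 * ∫ p, e p ^ 2 * (v ⬝ᵥ u p) ^ 2 ∂ρ := by
      have i4 : Integrable (fun p => α * (v ⬝ᵥ v)
          - α * (γ * 2 - γ ^ 2 * R) * (v ⬝ᵥ u p) ^ 2) ρ := (integrable_const _).sub i3
      rw [integral_add i4 (i2.const_mul _), integral_sub (integrable_const _) i3,
        integral_const, integral_const_mul, integral_const_mul]
      simp
    refine (le_of_eq e5).trans ?_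
    have a1 := mul_le_mul_of_nonneg_left (h.second v) (sq_nonneg γ)
    have a2 := hβ (v ⬝ᵥ v) (∫ p, (v ⬝ᵥ u p) ^ 2 ∂ρ) (integral_nonneg fun _ => sq_nonneg _)
      (h.integral_sq_dotProduct_le v)
    linarith

end Step

/-! ### Iterates along an i.i.d. sequence -/

/-- The iterates of stochastic gradient descent from `0` with step sizes `γ`. -/
def sgdIterate {m : ℕ} {X : Type*} (u : X → Fin m → ℝ) (e : X → ℝ) (γ : ℕ → ℝ) (z : ℕ → X) :
    ℕ → Fin m → ℝ
  | 0 => 0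
  | t + 1 => sgdStep u e (γ (t + 1)) (sgdIterate u e γ z t, z (t + 1))

theorem sgdIterate_congr {m : ℕ} {X : Type*} {u : X → Fin m → ℝ} {e : X → ℝ} {γ : ℕ → ℝ}
    {z z' : ℕ → X} (t : ℕ) (h : ∀ k, 1 ≤ k → k ≤ t → z k = z' k) :
    sgdIterate u e γ z t = sgdIterate u e γ z' t := by
  induction t with
  | zero => rfl
  | succ t ih =>
    simp only [sgdIterate]
    rw [ih fun k h1 h2 => h k h1 (by omega), h (t + 1) (by omega) le_rfl]

theorem lintegral_lintegral_const_mul_sum {Ω X ι : Type*} [MeasurableSpace Ω] [MeasurableSpace X]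
    {P : Measure Ω} {ρ : Measure X} [SFinite ρ] {F : ι → Ω × X → ℝ≥0∞}
    (hF : ∀ t, Measurable (F t)) {k : ℝ≥0∞} (hk : k ≠ ∞) (s : Finset ι) :
    ∫⁻ z, ∫⁻ p, k * ∑ t ∈ s, F t (z, p) ∂ρ ∂P = k * ∑ t ∈ s, ∫⁻ z, ∫⁻ p, F t (z, p) ∂ρ ∂P := by
  have h1 : ∀ z, ∫⁻ p, k * ∑ t ∈ s, F t (z, p) ∂ρ = k * ∑ t ∈ s, ∫⁻ p, F t (z, p) ∂ρ := by
    intro z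
    have hz : ∀ t ∈ s, Measurable fun p => F t (z, p) := fun t _ =>
      (hF t).comp measurable_prodMk_left
    rw [lintegral_const_mul' _ _ hk, lintegral_finsetSum _ hz]
  simp_rw [h1]
  rw [lintegral_const_mul' _ _ hk, lintegral_finsetSum _ fun t _ => (hF t).lintegral_prod_right']

section Iterate

variable {m : ℕ} {X : Type*} [MeasurableSpace X] {ρ : Measure X} [IsProbabilityMeasure ρ]
  {u : X → Fin m → ℝ} {e : X → ℝ} {R τ : ℝ} {γ : ℕ → ℝ}

theorem measurable_sgdIterate (hu : Measurable u) (he : Measurable e) (t : ℕ) :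
    Measurable fun z : ℕ → X => sgdIterate u e γ z t := by
  induction t with
  | zero => exact measurable_const
  | succ t ih =>
    exact (measurable_sgdStep hu he _).comp (ih.prodMk (measurable_pi_apply (t + 1)))

/-- The iterate at time `t` is a function of the samples up to time `t` only. -/
theorem indepFun_sgdIterate (hu : Measurable u) (he : Measurable e) (t : ℕ) :
    (fun z : ℕ → X => sgdIterate u e γ z t) ⟂ᵢ[Measure.infinitePi fun _ : ℕ => ρ]
      (fun z : ℕ → X => z (t + 1)) := by
  have hind : iIndepFun (fun (i : ℕ) (z : ℕ → X) => z i) (Measure.infinitePi fun _ : ℕ => ρ) :=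
    iIndepFun_infinitePi (X := fun _ x => x) fun _ => measurable_id
  have h := hind.indepFun_finset (Finset.range (t + 1)) {t + 1} (by simp) fun i =>
    measurable_pi_apply i
  obtain ⟨x₀⟩ : Nonempty X := nonempty_of_isProbabilityMeasure ρ
  -- Padding the coordinates `0, …, t` by an arbitrary point exhibits the iterate as a function of
  -- finitely many coordinates, so independence over disjoint finite index sets applies.
  let ext : (Finset.range (t + 1) → X) → ℕ → X := fun y k =>
    if hk : k ∈ Finset.range (t + 1) then y ⟨k, hk⟩ else x₀
  have hext : Measurable ext := by
    refine measurable_pi_lambda _ fun k => ?_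
    by_cases hk : k ∈ Finset.range (t + 1)
    · simp only [ext, hk, dite_true]
      exact measurable_pi_apply _
    · simp only [ext, hk, dite_false]
      exact measurable_const
  have h' := h.comp ((measurable_sgdIterate (γ := γ) hu he t).comp hext)
    (measurable_pi_apply (⟨t + 1, by simp⟩ : ({t + 1} : Finset ℕ)))
  have hrestrict : ((fun z => sgdIterate u e γ z t) ∘ ext) ∘
      (fun (z : ℕ → X) (i : Finset.range (t + 1)) => z i) = fun z => sgdIterate u e γ z t := by
    funext z
    refine (sgdIterate_congr t fun k _ h2 => ?_).symm
    have hk : k ∈ Finset.range (t + 1) := Finset.mem_range.2 (by omega)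
    simp only [ext, hk, dite_true]
  rw [hrestrict] at h'
  exact h'

/-- Independence of the fresh sample turns the iteration into a Markov recursion for laws, to which
the one-step bound applies. -/
theorem map_sgdIterate_succ (hu : Measurable u) (he : Measurable e) (t : ℕ) :
    (Measure.infinitePi fun _ : ℕ => ρ).map (fun z => sgdIterate u e γ z (t + 1))
      = (((Measure.infinitePi fun _ : ℕ => ρ).map fun z => sgdIterate u e γ z t).prod ρ).map
          (sgdStep u e (γ (t + 1))) := by
  have hm := measurable_sgdIterate (γ := γ) hu he t
  have h := (indepFun_iff_map_prod_eq_prod_map_map hm.aemeasurable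
    (measurable_pi_apply (t + 1)).aemeasurable).1
    (indepFun_sgdIterate (ρ := ρ) (γ := γ) hu he t)
  have h2 : (Measure.infinitePi fun _ : ℕ => ρ).map (fun z => z (t + 1)) = ρ :=
    Measure.infinitePi_map_eval (fun _ => ρ) (t + 1)
  rw [h2] at h
  rw [← h, Measure.map_map (measurable_sgdStep hu he _) (hm.prodMk (measurable_pi_apply _))]
  rfl

theorem momentBound_dirac_zero {α : ℝ} (hα : 0 ≤ α) :
    MomentBound (Measure.dirac (0 : Fin m → ℝ)) α := by
  refine ⟨fun i => ?_, fun v => ?_, fun v => ?_⟩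
  · exact (memLp_congr_ae (ae_eq_dirac' (a := (0 : Fin m → ℝ)) (measurable_pi_apply i))).2
      (memLp_const _)
  · rw [integral_dirac]
    simp
  · rw [integral_dirac]
    simpa using mul_nonneg hα (dotProduct_self_nonneg' v)

/-- An inductive criterion for covariance bounds on the iterates. -/
theorem momentBound_sgdIterate (h : NoiseModel ρ u e R τ) {α : ℕ → ℝ} (hα : ∀ t, 0 ≤ α t)
    (hstep : ∀ t, ∀ q S : ℝ, 0 ≤ S → S ≤ R * q →
      α t * q + (γ (t + 1) ^ 2 * τ ^ 2 - α t * (γ (t + 1) * 2 - γ (t + 1) ^ 2 * R)) * S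
        ≤ α (t + 1) * q) (t : ℕ) :
    MomentBound ((Measure.infinitePi fun _ : ℕ => ρ).map fun z => sgdIterate u e γ z t) (α t) := by
  induction t with
  | zero =>
    have : (Measure.infinitePi fun _ : ℕ => ρ).map (fun z => sgdIterate u e γ z 0)
        = Measure.dirac 0 := by
      simp only [sgdIterate]
      rw [Measure.map_const]
      simp
    rw [this]
    exact momentBound_dirac_zero (hα 0)
  | succ t ih =>
    have := Measure.isProbabilityMeasure_map (μ := Measure.infinitePi fun _ : ℕ => ρ)
      (measurable_sgdIterate (γ := γ) h.measurable_u h.measurable_e t).aemeasurable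
    rw [map_sgdIterate_succ h.measurable_u h.measurable_e]
    exact ih.step h (hα t) (hstep t)

/-- Small steps keep the covariance of the iterates at most `γ₀ τ²`. -/
theorem momentBound_sgdIterate_of_le_one (h : NoiseModel ρ u e R τ) {γ₀ : ℝ} (hγ₀ : 0 ≤ γ₀)
    (hγ : ∀ t, 0 ≤ γ (t + 1)) (hγ' : ∀ t, γ (t + 1) ≤ γ₀) (hR : γ₀ * R ≤ 1) (t : ℕ) :
    MomentBound ((Measure.infinitePi fun _ : ℕ => ρ).map fun z => sgdIterate u e γ z t)
      (γ₀ * τ ^ 2) := by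
  have hα : 0 ≤ γ₀ * τ ^ 2 := by positivity
  refine momentBound_sgdIterate h (α := fun _ => γ₀ * τ ^ 2) (fun _ => hα) (fun t q S hS _ => ?_) t
  have h1 := hγ t
  have h2 := hγ' t
  set g := γ (t + 1)
  have h3 : g * R ≤ 1 := (mul_le_mul_of_nonneg_right h2 h.nonneg).trans hR
  -- With `α = γ₀ τ²`, one half of the contraction `2 g α` absorbs the injected noise `g² τ²` since
  -- `g ≤ γ₀`, and the other half absorbs `α g² R` since `g R ≤ 1`.
  have h4 : g ^ 2 * τ ^ 2 - γ₀ * τ ^ 2 * (g * 2 - g ^ 2 * R) ≤ 0 := by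
    have e1 : g ^ 2 * τ ^ 2 - γ₀ * τ ^ 2 * (g * 2 - g ^ 2 * R)
        = -(g * τ ^ 2 * ((γ₀ - g) + γ₀ * (1 - g * R))) := by ring
    rw [e1, neg_nonpos]
    have : 0 ≤ 1 - g * R := by linarith
    have : 0 ≤ γ₀ - g := by linarith
    positivity
  have := mul_nonpos_of_nonpos_of_nonneg h4 hS
  linarith

/-- Without any restriction on the steps, the covariance grows at most exponentially. -/
theorem momentBound_sgdIterate_exp (h : NoiseModel ρ u e R τ) {γ₀ : ℝ} (hγ₀ : 0 ≤ γ₀)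
    (hγ : ∀ t, 0 ≤ γ (t + 1)) (hγ' : ∀ t, γ (t + 1) ≤ γ₀) (t : ℕ) :
    MomentBound ((Measure.infinitePi fun _ : ℕ => ρ).map fun z => sgdIterate u e γ z t)
      (γ₀ * τ ^ 2 * (1 + γ₀ * R) ^ (2 * t)) := by
  have hR := h.nonneg
  have hQ : 0 ≤ γ₀ * R := mul_nonneg hγ₀ hR
  refine momentBound_sgdIterate h (α := fun t => γ₀ * τ ^ 2 * (1 + γ₀ * R) ^ (2 * t))
    (fun _ => by positivity) (fun t q S hS hSR => ?_) t
  have h1 := hγ t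
  have h2 := hγ' t
  set g := γ (t + 1)
  set K := (1 + γ₀ * R) ^ (2 * t) with hK
  have hK1 : 1 ≤ K := one_le_pow₀ (by linarith)
  have hRq : 0 ≤ R * q := hS.trans hSR
  have hg2 : g ^ 2 ≤ γ₀ ^ 2 := pow_le_pow_left₀ h1 h2 2
  have e1 : (1 + γ₀ * R) ^ (2 * (t + 1)) = K * (1 + γ₀ * R) ^ 2 := by rw [hK]; ring
  rw [e1]
  -- The contraction is discarded. With `Q = γ₀ R`, the noise costs a relative increase `Q` (this
  -- uses `1 ≤ K`) and the quadratic term costs `Q²`; both fit into `(1 + Q)²`, whence the exponent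
  -- `2 * t`.
  have b1 : (g ^ 2 * τ ^ 2 - γ₀ * τ ^ 2 * K * (g * 2 - g ^ 2 * R)) * S
      ≤ (γ₀ ^ 2 * τ ^ 2 * K + γ₀ * τ ^ 2 * K * (γ₀ ^ 2 * R)) * (R * q) := by
    have c1 : g ^ 2 * τ ^ 2 - γ₀ * τ ^ 2 * K * (g * 2 - g ^ 2 * R)
        ≤ γ₀ ^ 2 * τ ^ 2 * K + γ₀ * τ ^ 2 * K * (γ₀ ^ 2 * R) := by
      have d1 : g ^ 2 * τ ^ 2 ≤ γ₀ ^ 2 * τ ^ 2 * K :=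
        (mul_le_mul_of_nonneg_right hg2 (sq_nonneg τ)).trans
          (le_mul_of_one_le_right (by positivity) hK1)
      have d2 : γ₀ * τ ^ 2 * K * (g ^ 2 * R) ≤ γ₀ * τ ^ 2 * K * (γ₀ ^ 2 * R) := by gcongr
      have d3 : 0 ≤ γ₀ * τ ^ 2 * K * (g * 2) := by positivity
      linarith
    exact mul_le_mul c1 hSR hS (by positivity)
  have e2 : γ₀ * τ ^ 2 * (K * (1 + γ₀ * R) ^ 2) * q = γ₀ * τ ^ 2 * K * q
      + (γ₀ ^ 2 * τ ^ 2 * K + γ₀ * τ ^ 2 * K * (γ₀ ^ 2 * R)) * (R * q)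
      + γ₀ ^ 2 * τ ^ 2 * K * (R * q) := by ring
  have e3 : 0 ≤ γ₀ ^ 2 * τ ^ 2 * K * (R * q) := by positivity
  linarith

/-- The excess risk of the averaged iterate under a uniform covariance bound. -/
theorem lintegral_average_le (h : NoiseModel ρ u e R τ) {α : ℝ} (hα : 0 ≤ α) {n : ℕ} (hn : 0 < n)
    (hb : ∀ t < n, MomentBound
      ((Measure.infinitePi fun _ : ℕ => ρ).map fun z => sgdIterate u e γ z t) α) :
    ∫⁻ z, ∫⁻ p, ENNReal.ofReal
        ((((1 / (n : ℝ)) • ∑ t ∈ Finset.range n, sgdIterate u e γ z t) ⬝ᵥ u p) ^ 2)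
      ∂ρ ∂(Measure.infinitePi fun _ : ℕ => ρ) ≤ ENNReal.ofReal (α * R) := by
  set P := Measure.infinitePi fun _ : ℕ => ρ
  have hn' : (0 : ℝ) < n := by exact_mod_cast hn
  have hit := fun t => measurable_sgdIterate (γ := γ) h.measurable_u h.measurable_e t
  have hF : ∀ t, Measurable fun q : (ℕ → X) × X =>
      ENNReal.ofReal ((sgdIterate u e γ q.1 t ⬝ᵥ u q.2) ^ 2) := fun t =>
    ((measurable_dotProduct' ((hit t).comp measurable_fst)
      (h.measurable_u.comp measurable_snd)).pow_const 2).ennreal_ofReal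
  -- Convexity of the square reduces the average to single iterates.
  have hconv : ∀ z p, ENNReal.ofReal
        ((((1 / (n : ℝ)) • ∑ t ∈ Finset.range n, sgdIterate u e γ z t) ⬝ᵥ u p) ^ 2)
      ≤ ENNReal.ofReal (1 / (n : ℝ)) *
        ∑ t ∈ Finset.range n, ENNReal.ofReal ((sgdIterate u e γ z t ⬝ᵥ u p) ^ 2) := by
    intro z p
    rw [← ENNReal.ofReal_sum_of_nonneg fun _ _ => sq_nonneg _,
      ← ENNReal.ofReal_mul (by positivity)]
    refine ENNReal.ofReal_le_ofReal ?_
    rw [smul_dotProduct, sum_dotProduct, smul_eq_mul, mul_pow]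
    have := sq_sum_le_card_mul_sum_sq (s := Finset.range n)
      (f := fun t => sgdIterate u e γ z t ⬝ᵥ u p)
    rw [Finset.card_range] at this
    calc _ ≤ (1 / (n : ℝ)) ^ 2 * (n * ∑ t ∈ Finset.range n, (sgdIterate u e γ z t ⬝ᵥ u p) ^ 2) := by
          gcongr
      _ = _ := by field_simp
  have hone : ∀ t < n, ∫⁻ z, ∫⁻ p, ENNReal.ofReal ((sgdIterate u e γ z t ⬝ᵥ u p) ^ 2) ∂ρ ∂P
      ≤ ENNReal.ofReal (α * R) := by
    intro t ht
    -- The test point `p` is independent of the iterates, so after swapping it can be fixed and the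
    -- covariance bound used in the direction `u p`.
    rw [lintegral_lintegral_swap (hF t).aemeasurable]
    have : ∀ᵐ p ∂ρ, ∫⁻ z, ENNReal.ofReal ((sgdIterate u e γ z t ⬝ᵥ u p) ^ 2) ∂P
        ≤ ENNReal.ofReal (α * R) := by
      filter_upwards [h.bound] with p hp
      have hmp : Measurable fun η : Fin m → ℝ => (u p ⬝ᵥ η) ^ 2 :=
        (measurable_dotProduct' measurable_const measurable_id).pow_const 2
      have e1 : ∫⁻ z, ENNReal.ofReal ((sgdIterate u e γ z t ⬝ᵥ u p) ^ 2) ∂P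
          = ∫⁻ η, ENNReal.ofReal ((u p ⬝ᵥ η) ^ 2) ∂(P.map fun z => sgdIterate u e γ z t) := by
        rw [lintegral_map hmp.ennreal_ofReal (hit t)]
        simp_rw [dotProduct_comm]
      have i1 : Integrable (fun η => (u p ⬝ᵥ η) ^ 2) (P.map fun z => sgdIterate u e γ z t) :=
        (memLp_dotProduct (hb t ht).memLp (u p)).integrable_sq
      rw [e1, ← ofReal_integral_eq_lintegral_ofReal i1 (ae_of_all _ fun _ => sq_nonneg _)]
      exact ENNReal.ofReal_le_ofReal (((hb t ht).second _).trans
        (mul_le_mul_of_nonneg_left hp hα))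
    refine (lintegral_mono_ae this).trans ?_
    simp
  calc _ ≤ ∫⁻ z, ∫⁻ p, ENNReal.ofReal (1 / (n : ℝ)) *
        ∑ t ∈ Finset.range n, ENNReal.ofReal ((sgdIterate u e γ z t ⬝ᵥ u p) ^ 2) ∂ρ ∂P :=
        lintegral_mono fun z => lintegral_mono fun p => hconv z p
    _ = ENNReal.ofReal (1 / (n : ℝ)) * ∑ t ∈ Finset.range n,
        ∫⁻ z, ∫⁻ p, ENNReal.ofReal ((sgdIterate u e γ z t ⬝ᵥ u p) ^ 2) ∂ρ ∂P := by
        exact lintegral_lintegral_const_mul_sum (P := P) (ρ := ρ) hF ENNReal.ofReal_ne_top _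
    _ ≤ ENNReal.ofReal (1 / (n : ℝ)) * ∑ t ∈ Finset.range n, ENNReal.ofReal (α * R) := by
        gcongr with t ht
        exact hone t (Finset.mem_range.1 ht)
    _ = ENNReal.ofReal (α * R) := by
        rw [Finset.sum_const, Finset.card_range, nsmul_eq_mul, ← ENNReal.ofReal_natCast n,
          ← mul_assoc, ← ENNReal.ofReal_mul (by positivity)]
        rw [one_div, inv_mul_cancel₀ hn'.ne', ENNReal.ofReal_one, one_mul]

end Iterate

/-! ### Gaussian exponential moments -/

/-- The law of `⟨w, x⟩` for a standard Gaussian vector `w`. -/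
theorem map_pi_gaussianReal_sum_mul {ι : Type*} [Fintype ι] (x : ι → ℝ) :
    (Measure.pi fun _ : ι => gaussianReal 0 1).map (fun w => ∑ j, w j * x j)
      = gaussianReal 0 (∑ j, x j ^ 2).toNNReal := by
  have hm : Measurable fun w : ι → ℝ => ∑ j, w j * x j := by fun_prop
  have := Measure.isProbabilityMeasure_map (μ := Measure.pi fun _ : ι => gaussianReal 0 1)
    hm.aemeasurable
  refine Measure.ext_of_charFun ?_
  ext t
  have hm2 : Measurable fun s : ℝ => Complex.exp (t * s * Complex.I) := by fun_prop
  rw [charFun_apply_real, integral_map hm.aemeasurable hm2.aestronglyMeasurable,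
    charFun_gaussianReal]
  have e1 : ∀ w : ι → ℝ, Complex.exp (t * ((∑ j, w j * x j : ℝ) : ℂ) * Complex.I)
      = ∏ j, Complex.exp (((t * x j : ℝ) : ℂ) * w j * Complex.I) := by
    intro w
    rw [← Complex.exp_sum]
    congr 1
    push_cast
    rw [Finset.mul_sum, Finset.sum_mul]
    refine Finset.sum_congr rfl fun j _ => ?_
    ring
  simp_rw [e1]
  rw [integral_fintype_prod_eq_prod
    (f := fun j (s : ℝ) => Complex.exp (((t * x j : ℝ) : ℂ) * s * Complex.I))]
  simp_rw [← charFun_apply_real, charFun_gaussianReal]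
  rw [← Complex.exp_sum]
  congr 1
  have h0 : 0 ≤ ∑ j, x j ^ 2 := Finset.sum_nonneg fun _ _ => sq_nonneg _
  have e2 : (((∑ j, x j ^ 2).toNNReal : ℝ≥0) : ℂ) = ∑ j, (x j : ℂ) ^ 2 := by
    have e3 : (((∑ j, x j ^ 2).toNNReal : ℝ≥0) : ℝ) = ∑ j, x j ^ 2 := Real.coe_toNNReal _ h0
    exact_mod_cast congrArg (fun r : ℝ => (r : ℂ)) e3
  rw [e2, Finset.sum_mul, Finset.sum_div]
  push_cast
  simp only [mul_zero, zero_mul, zero_sub, one_mul, Finset.sum_neg_distrib]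
  congr 1
  refine Finset.sum_congr rfl fun j _ => ?_
  ring

/-- Against the density, `exp (s² / 4)` leaves the kernel of a Gaussian of variance `2`; the exact
value is `√2`, rounded up to `2`. -/
theorem lintegral_exp_sq_gaussianReal_one :
    ∫⁻ s, ENNReal.ofReal (Real.exp (s ^ 2 / 4)) ∂(gaussianReal 0 1) ≤ 2 := by
  rw [gaussianReal_of_var_ne_zero 0 one_ne_zero,
    lintegral_withDensity_eq_lintegral_mul _ (measurable_gaussianPDF 0 1) (by fun_prop)]
  have e1 : ∀ s : ℝ, (gaussianPDF 0 1 * fun s => ENNReal.ofReal (Real.exp (s ^ 2 / 4))) s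
      = ENNReal.ofReal ((√(2 * Real.pi))⁻¹ * Real.exp (-(1 / 4) * s ^ 2)) := by
    intro s
    rw [Pi.mul_apply, gaussianPDF, ← ENNReal.ofReal_mul (gaussianPDFReal_nonneg _ _ _),
      gaussianPDFReal, mul_assoc, ← Real.exp_add]
    congr 3
    · simp
    · simp; ring
  have hi : Integrable fun s : ℝ => (√(2 * Real.pi))⁻¹ * Real.exp (-(1 / 4) * s ^ 2) :=
    (integrable_exp_neg_mul_sq (by norm_num)).const_mul _
  simp_rw [e1]
  rw [← ofReal_integral_eq_lintegral_ofReal hi (ae_of_all _ fun s => by positivity),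
    integral_const_mul, integral_gaussian, ← ENNReal.ofReal_ofNat]
  refine ENNReal.ofReal_le_ofReal ?_
  have hp := Real.pi_pos
  rw [← Real.sqrt_inv, ← Real.sqrt_mul (by positivity)]
  refine Real.sqrt_le_iff.2 ⟨by norm_num, ?_⟩
  field_simp
  norm_num

theorem lintegral_exp_sq_gaussianReal {v : ℝ≥0} (hv : v ≤ 1) :
    ∫⁻ s, ENNReal.ofReal (Real.exp (s ^ 2 / 4)) ∂(gaussianReal 0 v) ≤ 2 := by
  have e1 : (gaussianReal 0 1).map (fun s => √v * s) = gaussianReal 0 v := by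
    rw [gaussianReal_map_const_mul]
    congr 1
    · simp
    · ext
      simp
  rw [← e1, lintegral_map (by fun_prop) (by fun_prop)]
  refine (lintegral_mono fun s => ?_).trans lintegral_exp_sq_gaussianReal_one
  refine ENNReal.ofReal_le_ofReal (Real.exp_le_exp.2 ?_)
  rw [mul_pow, Real.sq_sqrt v.coe_nonneg]
  have : (v : ℝ) ≤ 1 := by exact_mod_cast hv
  nlinarith [sq_nonneg s]

instance {m d : ℕ} : IsProbabilityMeasure (weightLaw m d) := by
  unfold weightLaw
  infer_instance

/-! ### Operator norm of a Gaussian matrix -/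

/-- The weight matrix as an operator between Euclidean spaces. -/
def weightOp {m d : ℕ} (W : Fin m → Fin d → ℝ) :
    EuclideanSpace ℝ (Fin d) →L[ℝ] EuclideanSpace ℝ (Fin m) :=
  LinearMap.toContinuousLinearMap (Matrix.toLpLin 2 2 (Matrix.of W))

section Weight

variable {m d : ℕ}

theorem weightOp_apply (W : Fin m → Fin d → ℝ) (x : EuclideanSpace ℝ (Fin d)) (i : Fin m) :
    weightOp W x i = ∑ j, W i j * x j := by
  simp [weightOp, Matrix.toLpLin_apply, Matrix.mulVec, dotProduct]

theorem norm_sq_weightOp_apply (W : Fin m → Fin d → ℝ) (x : EuclideanSpace ℝ (Fin d)) :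
    ‖weightOp W x‖ ^ 2 = ∑ i, (∑ j, W i j * x j) ^ 2 := by
  rw [EuclideanSpace.real_norm_sq_eq]
  simp_rw [weightOp_apply]

theorem measurable_norm_weightOp :
    Measurable fun W : Fin m → Fin d → ℝ => ‖weightOp W‖ := by
  have : Continuous fun W : Fin m → Fin d → ℝ => weightOp W := by
    let L : (Fin m → Fin d → ℝ) →ₗ[ℝ] EuclideanSpace ℝ (Fin d) →L[ℝ] EuclideanSpace ℝ (Fin m) :=
      { toFun := weightOp
        map_add' := fun W V => by
          ext x i
          simp [weightOp_apply, add_mul, Finset.sum_add_distrib]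
        map_smul' := fun c W => by
          ext x i
          simp [weightOp_apply, Finset.mul_sum, mul_assoc] }
    exact L.continuous_of_finiteDimensional
  exact this.norm.measurable

theorem measurable_norm_sq_weightOp_apply :
    Measurable fun q : (Fin m → Fin d → ℝ) × EuclideanSpace ℝ (Fin d) =>
      ‖weightOp q.1 q.2‖ ^ 2 := by
  simp_rw [norm_sq_weightOp_apply]
  fun_prop

theorem map_weightLaw_row (i : Fin m) (x : EuclideanSpace ℝ (Fin d)) :
    (weightLaw m d).map (fun W => ∑ j, W i j * x j) = gaussianReal 0 (‖x‖ ^ 2).toNNReal := by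
  have h1 : (weightLaw m d).map (fun W => W i) = Measure.pi fun _ : Fin d => gaussianReal 0 1 :=
    (measurePreserving_eval (fun _ : Fin m => Measure.pi fun _ : Fin d => gaussianReal 0 1) i).map_eq
  rw [EuclideanSpace.real_norm_sq_eq, ← map_pi_gaussianReal_sum_mul, ← h1,
    Measure.map_map (by fun_prop) (by fun_prop)]
  rfl

/-- The `m` rows are independent, and each contributes a centered Gaussian of variance `‖u‖² ≤ 1`,
hence a factor of at most `2`. -/
theorem lintegral_exp_norm_weightOp_apply {u : EuclideanSpace ℝ (Fin d)} (hu : ‖u‖ ≤ 1) :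
    ∫⁻ W, ENNReal.ofReal (Real.exp (‖weightOp W u‖ ^ 2 / 4)) ∂(weightLaw m d) ≤ 2 ^ m := by
  have hind : iIndepFun (fun (i : Fin m) (W : Fin m → Fin d → ℝ) =>
      ENNReal.ofReal (Real.exp ((∑ j, W i j * u j) ^ 2 / 4))) (weightLaw m d) :=
    iIndepFun_pi (μ := fun _ : Fin m => Measure.pi fun _ : Fin d => gaussianReal 0 1)
      (X := fun _ (w : Fin d → ℝ) => ENNReal.ofReal (Real.exp ((∑ j, w j * u j) ^ 2 / 4)))
      fun _ => Measurable.aemeasurable (by fun_prop)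
  have e1 : ∀ W : Fin m → Fin d → ℝ, ENNReal.ofReal (Real.exp (‖weightOp W u‖ ^ 2 / 4))
      = ∏ i, ENNReal.ofReal (Real.exp ((∑ j, W i j * u j) ^ 2 / 4)) := by
    intro W
    rw [norm_sq_weightOp_apply, Finset.sum_div, Real.exp_sum,
      ENNReal.ofReal_prod_of_nonneg fun _ _ => (Real.exp_pos _).le]
  simp_rw [e1]
  rw [lintegral_prod_eq_prod_lintegral_of_indepFun _ _ hind fun i => by fun_prop]
  refine (Finset.prod_le_prod' fun i _ => ?_ : _ ≤ ∏ _i : Fin m, (2 : ℝ≥0∞)).trans (by simp)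
  have hv : (‖u‖ ^ 2).toNNReal ≤ 1 := by
    rw [Real.toNNReal_le_one]
    exact pow_le_one₀ (norm_nonneg _) hu
  refine le_trans (le_of_eq ?_) (lintegral_exp_sq_gaussianReal hv)
  rw [← map_weightLaw_row i u, lintegral_map (by fun_prop) (by fun_prop)]

/-- The operator norm is controlled by an exponential average over the unit ball. -/
theorem exp_norm_sq_mul_volume_le (W : Fin m → Fin d → ℝ) :
    ENNReal.ofReal (Real.exp (‖weightOp W‖ ^ 2 / 256)) *
        volume (Metric.ball (0 : EuclideanSpace ℝ (Fin d)) 1)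
      ≤ 8 ^ d * ∫⁻ u in Metric.ball (0 : EuclideanSpace ℝ (Fin d)) 1,
          ENNReal.ofReal (Real.exp (‖weightOp W u‖ ^ 2 / 4)) := by
  -- Averaging over a small ball takes the place of a net. A vector `u` nearly attaining the norm is
  -- halved, so that the ball of radius `1 / 8` about `c = u / 2` stays in the unit ball. There `‖W
  -- v‖ ≥ ‖W‖ / 4 - ‖W‖ / 8`, so `256 = 4 * 8²`, and the volume ratio is `8 ^ d`.
  obtain ⟨u, hu1, hu2⟩ : ∃ u, ‖u‖ ≤ 1 ∧ ‖weightOp W‖ / 2 ≤ ‖weightOp W u‖ := by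
    rcases (norm_nonneg (weightOp W)).eq_or_lt with h | h
    · exact ⟨0, by simp, by simp [← h]⟩
    · obtain ⟨u, h1, h2⟩ := (weightOp W).exists_lt_apply_of_lt_opNorm (half_lt_self h)
      exact ⟨u, h1.le, h2.le⟩
  set c : EuclideanSpace ℝ (Fin d) := (1 / 2 : ℝ) • u with hc
  have hcn : ‖c‖ ≤ 1 / 2 := by
    rw [hc, norm_smul]
    norm_num
    linarith
  have hsub : Metric.ball c (1 / 8) ⊆ Metric.ball 0 1 :=
    Metric.ball_subset_ball' (by rw [dist_zero_right]; linarith)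
  have hlow : ∀ v ∈ Metric.ball c (1 / 8), ‖weightOp W‖ / 8 ≤ ‖weightOp W v‖ := by
    intro v hv
    have h1 : ‖weightOp W (c - v)‖ ≤ ‖weightOp W‖ * (1 / 8) := by
      refine ((weightOp W).le_opNorm _).trans (mul_le_mul_of_nonneg_left ?_ (norm_nonneg _))
      rw [← dist_eq_norm, dist_comm]
      exact (Metric.mem_ball.1 hv).le
    have h2 : ‖weightOp W c‖ = 1 / 2 * ‖weightOp W u‖ := by
      rw [hc, map_smul, norm_smul]
      norm_num
    have h3 : ‖weightOp W c‖ ≤ ‖weightOp W v‖ + ‖weightOp W (c - v)‖ := by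
      rw [map_sub]
      have := norm_add_le (weightOp W v) (weightOp W c - weightOp W v)
      rwa [add_sub_cancel] at this
    linarith
  have hvol : volume (Metric.ball (0 : EuclideanSpace ℝ (Fin d)) 1)
      = 8 ^ d * volume (Metric.ball c (1 / 8)) := by
    rw [Measure.addHaar_ball_of_pos volume c (by norm_num : (0 : ℝ) < 1 / 8), ← mul_assoc,
      finrank_euclideanSpace_fin, ENNReal.ofReal_pow (by norm_num), ← mul_pow,
      ← ENNReal.ofReal_ofNat 8, ← ENNReal.ofReal_mul (by norm_num)]
    norm_num
  have h4 : ENNReal.ofReal (Real.exp (‖weightOp W‖ ^ 2 / 256)) * volume (Metric.ball c (1 / 8))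
      ≤ ∫⁻ v in Metric.ball c (1 / 8), ENNReal.ofReal (Real.exp (‖weightOp W v‖ ^ 2 / 4)) := by
    rw [← setLIntegral_const]
    refine setLIntegral_mono' Metric.isOpen_ball.measurableSet fun v hv => ?_
    refine ENNReal.ofReal_le_ofReal (Real.exp_le_exp.2 ?_)
    have := pow_le_pow_left₀ (by positivity) (hlow v hv) 2
    linarith
  rw [hvol, mul_left_comm]
  gcongr
  exact h4.trans (lintegral_mono_set hsub)

/-- An exponential moment of the operator norm of a Gaussian matrix. -/
theorem lintegral_exp_norm_weightOp (m d : ℕ) :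
    ∫⁻ W, ENNReal.ofReal (Real.exp (‖weightOp W‖ ^ 2 / 256)) ∂(weightLaw m d)
      ≤ 8 ^ d * 2 ^ m := by
  set B := Metric.ball (0 : EuclideanSpace ℝ (Fin d)) 1
  have hB0 : volume B ≠ 0 := (Metric.measure_ball_pos volume _ one_pos).ne'
  have hB1 : volume B ≠ ∞ := measure_ball_lt_top.ne
  have hm : Measurable fun q : (Fin m → Fin d → ℝ) × EuclideanSpace ℝ (Fin d) =>
      ENNReal.ofReal (Real.exp (‖weightOp q.1 q.2‖ ^ 2 / 4)) :=
    (Real.measurable_exp.comp (measurable_norm_sq_weightOp_apply.div_const 4)).ennreal_ofReal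
  have h1 : (∫⁻ W, ENNReal.ofReal (Real.exp (‖weightOp W‖ ^ 2 / 256)) ∂(weightLaw m d)) * volume B
      ≤ 8 ^ d * 2 ^ m * volume B := by
    rw [← lintegral_mul_const' _ _ hB1]
    refine (lintegral_mono fun W => exp_norm_sq_mul_volume_le W).trans ?_
    rw [lintegral_const_mul' _ _ (by simp), lintegral_lintegral_swap hm.aemeasurable, mul_assoc]
    gcongr
    rw [← setLIntegral_const]
    refine setLIntegral_mono' Metric.isOpen_ball.measurableSet fun u hu => ?_
    exact lintegral_exp_norm_weightOp_apply (by simpa using (Metric.mem_ball.1 hu).le)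
  exact (ENNReal.mul_le_mul_iff_left hB0 hB1).1 h1

end Weight

/-! ### Size of the features -/

section Feature

variable {m d : ℕ} {σ : ℝ → ℝ}

theorem measurable_feature_uncurry (hσ : Continuous σ) :
    Measurable fun q : (Fin m → Fin d → ℝ) × EuclideanSpace ℝ (Fin d) => feature σ q.1 q.2 := by
  unfold feature
  have := hσ.measurable
  fun_prop

theorem measurable_feature (hσ : Continuous σ) (W : Fin m → Fin d → ℝ) :
    Measurable (feature σ W) :=
  (measurable_feature_uncurry hσ).comp measurable_prodMk_left

theorem sq_le_of_lipschitzWith {L : ℝ≥0} (hσ : LipschitzWith L σ) (t : ℝ) :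
    σ t ^ 2 ≤ 2 * σ 0 ^ 2 + 2 * L ^ 2 * t ^ 2 := by
  have h1 := hσ.dist_le_mul t 0
  rw [Real.dist_eq, Real.dist_eq, sub_zero] at h1
  have h2 : (σ t - σ 0) ^ 2 ≤ (L : ℝ) ^ 2 * t ^ 2 := by
    rw [← sq_abs (σ t - σ 0), ← sq_abs t, ← mul_pow]
    exact pow_le_pow_left₀ (abs_nonneg _) h1 2
  -- The slack in `σ t² ≤ 2 (σ t - σ 0)² + 2 σ 0²` is exactly `(σ t - 2 σ 0)²`.
  nlinarith [sq_nonneg (σ t - 2 * σ 0)]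

/-- Linear growth of `σ` reduces the sum over neurons to `‖W x‖²`. The resulting bound depends on
`W` only through its operator norm and is uniform over the data. -/
theorem feature_dotProduct_self_le {L : ℝ≥0} (hσ : LipschitzWith L σ) (hm : 0 < m) (hd : 0 < d)
    (W : Fin m → Fin d → ℝ) {x : EuclideanSpace ℝ (Fin d)} {B : ℝ} (hx : ‖x‖ ^ 2 ≤ B * d) :
    feature σ W x ⬝ᵥ feature σ W x ≤ 2 * σ 0 ^ 2 + 2 * L ^ 2 * B * (‖weightOp W‖ ^ 2 / m) := by
  have hm' : (0 : ℝ) < m := by exact_mod_cast hm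
  have hd' : (0 : ℝ) < d := by exact_mod_cast hd
  have h1 : ∀ i, feature σ W x i * feature σ W x i
      ≤ (2 * σ 0 ^ 2 + 2 * L ^ 2 * ((∑ j, W i j * x j) ^ 2 / d)) / m := by
    intro i
    have h2 := sq_le_of_lipschitzWith hσ ((∑ j, W i j * x j) / √(d : ℝ))
    rw [div_pow, Real.sq_sqrt hd'.le] at h2
    simp only [feature]
    rw [div_mul_div_comm, ← pow_two, Real.mul_self_sqrt hm'.le]
    gcongr
  have h3 : ∑ i, (∑ j, W i j * x j) ^ 2 ≤ ‖weightOp W‖ ^ 2 * (B * d) := by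
    rw [← norm_sq_weightOp_apply]
    refine (pow_le_pow_left₀ (norm_nonneg _) ((weightOp W).le_opNorm x) 2).trans ?_
    rw [mul_pow]
    gcongr
  calc feature σ W x ⬝ᵥ feature σ W x
      ≤ ∑ i, (2 * σ 0 ^ 2 + 2 * L ^ 2 * ((∑ j, W i j * x j) ^ 2 / d)) / m :=
        Finset.sum_le_sum fun i _ => h1 i
    _ = 2 * σ 0 ^ 2 + 2 * L ^ 2 * (∑ i, (∑ j, W i j * x j) ^ 2) / (d * m) := by
        rw [← Finset.sum_div, Finset.sum_add_distrib, ← Finset.mul_sum (f := fun i =>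
          (∑ j, W i j * x j) ^ 2 / (d : ℝ)), ← Finset.sum_div]
        simp only [Finset.sum_const, Finset.card_univ, Fintype.card_fin, nsmul_eq_mul]
        field_simp
    _ ≤ 2 * σ 0 ^ 2 + 2 * L ^ 2 * (‖weightOp W‖ ^ 2 * (B * d)) / (d * m) := by gcongr
    _ = _ := by field_simp

theorem dotProduct_vecMulVec_mulVec (v u : Fin m → ℝ) :
    v ⬝ᵥ (Matrix.vecMulVec u u *ᵥ v) = (v ⬝ᵥ u) ^ 2 := by
  rw [Matrix.vecMulVec_mulVec]
  simp only [op_smul_eq_smul, dotProduct_smul, smul_eq_mul, dotProduct_comm u v]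
  ring

/-- Quadratic forms commute with entrywise expectations. -/
theorem dotProduct_matrixExp_mulVec {Ω : Type*} [MeasurableSpace Ω] {μ : Measure Ω}
    {F : Ω → Matrix (Fin m) (Fin m) ℝ} (hF : ∀ i j, Integrable (fun ω => F ω i j) μ)
    (v : Fin m → ℝ) :
    v ⬝ᵥ (matrixExp μ F *ᵥ v) = ∫ ω, v ⬝ᵥ (F ω *ᵥ v) ∂μ := by
  simp only [dotProduct, Matrix.mulVec, matrixExp, Matrix.of_apply]
  rw [integral_finsetSum _ fun i _ => (integrable_finsetSum _ fun j _ =>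
    (hF i j).mul_const _).const_mul _]
  refine Finset.sum_congr rfl fun i _ => ?_
  rw [integral_const_mul, integral_finsetSum _ fun j _ => (hF i j).mul_const _]
  simp_rw [integral_mul_const]

theorem memLp_top_feature {ρ : Measure (EuclideanSpace ℝ (Fin d) × ℝ)}
    {W : Fin m → Fin d → ℝ} {R : ℝ} (hσ : Continuous σ)
    (hR : ∀ᵐ p ∂ρ, feature σ W p.1 ⬝ᵥ feature σ W p.1 ≤ R) (i : Fin m) :
    MemLp (fun p => feature σ W p.1 i) ∞ ρ := by
  refine memLp_top_of_bound ((measurable_pi_apply i).comp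
    ((measurable_feature hσ W).comp measurable_fst)).aestronglyMeasurable (√R) ?_
  filter_upwards [hR] with p hp
  exact Real.abs_le_sqrt ((sq_apply_le_dotProduct_self _ i).trans hp)

end Feature

/-! ### The variance for fixed weights -/

section Conditional

variable {m d : ℕ} {σ : ℝ → ℝ} {ρ : Measure (EuclideanSpace ℝ (Fin d) × ℝ)}
  [IsProbabilityMeasure ρ] {θ : (Fin m → Fin d → ℝ) → Fin m → ℝ} {W : Fin m → Fin d → ℝ} {R τ : ℝ}

theorem integrable_featureOuter (hσ : Continuous σ)
    (hR : ∀ᵐ p ∂ρ, feature σ W p.1 ⬝ᵥ feature σ W p.1 ≤ R) (i j : Fin m) :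
    Integrable (fun p => featureOuter σ W p.1 i j) ρ := by
  simp only [featureOuter, Matrix.vecMulVec_apply]
  exact ((memLp_top_feature hσ hR j).mul (p := ∞) (q := ∞) (r := ∞)
    (memLp_top_feature hσ hR i)).integrable le_top

theorem dotProduct_featureCov_mulVec (hσ : Continuous σ)
    (hR : ∀ᵐ p ∂ρ, feature σ W p.1 ⬝ᵥ feature σ W p.1 ≤ R) (v : Fin m → ℝ) :
    v ⬝ᵥ (featureCov σ ρ W *ᵥ v) = ∫ p, (v ⬝ᵥ feature σ W p.1) ^ 2 ∂ρ := by
  rw [featureCov, dotProduct_matrixExp_mulVec (integrable_featureOuter hσ hR)]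
  simp_rw [featureOuter, dotProduct_vecMulVec_mulVec]

theorem measurable_noise (hσ : Continuous σ) : Measurable (noise σ θ W) := by
  unfold noise
  exact measurable_snd.sub (measurable_dotProduct' measurable_const
    ((measurable_feature hσ W).comp measurable_fst))

theorem memLp_noise (hσ : Continuous σ)
    (hR : ∀ᵐ p ∂ρ, feature σ W p.1 ⬝ᵥ feature σ W p.1 ≤ R)
    (hy : MemLp (fun p : EuclideanSpace ℝ (Fin d) × ℝ => p.2) 2 ρ) :
    MemLp (noise σ θ W) 2 ρ :=
  hy.sub ((memLp_dotProduct (memLp_top_feature hσ hR) (θ W)).mono_exponent le_top)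

/-- The first order condition for the best predictor: the noise is uncorrelated with the
features. -/
theorem integral_noise_mul (hσ : Continuous σ)
    (hR : ∀ᵐ p ∂ρ, feature σ W p.1 ⬝ᵥ feature σ W p.1 ≤ R)
    (hy : MemLp (fun p : EuclideanSpace ℝ (Fin d) × ℝ => p.2) 2 ρ)
    (hθ : IsMinOn (risk σ ρ W) Set.univ (θ W)) (v : Fin m → ℝ) :
    ∫ p, noise σ θ W p * (v ⬝ᵥ feature σ W p.1) ∂ρ = 0 := by
  have hv := memLp_dotProduct (memLp_top_feature hσ hR) v
  have he : MemLp (noise σ θ W) 2 ρ := memLp_noise hσ hR hy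
  have i1 : Integrable (fun p => noise σ θ W p ^ 2) ρ := he.integrable_sq
  have i2 : Integrable (fun p => noise σ θ W p * (v ⬝ᵥ feature σ W p.1)) ρ :=
    (hv.mul (p := 2) (q := ∞) (r := 2) he).integrable one_le_two
  have i3 : Integrable (fun p => (v ⬝ᵥ feature σ W p.1) ^ 2) ρ :=
    (hv.mono_exponent le_top).integrable_sq
  set I := ∫ p, noise σ θ W p * (v ⬝ᵥ feature σ W p.1) ∂ρ
  set S := ∫ p, (v ⬝ᵥ feature σ W p.1) ^ 2 ∂ρ
  have hrisk : ∀ s : ℝ, risk σ ρ W (θ W + s • v)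
      = ∫ p, noise σ θ W p ^ 2 ∂ρ - 2 * s * I + s ^ 2 * S := by
    intro s
    have e1 : ∀ p : EuclideanSpace ℝ (Fin d) × ℝ,
        ((θ W + s • v) ⬝ᵥ feature σ W p.1 - p.2) ^ 2
        = noise σ θ W p ^ 2 - 2 * s * (noise σ θ W p * (v ⬝ᵥ feature σ W p.1))
          + s ^ 2 * (v ⬝ᵥ feature σ W p.1) ^ 2 := by
      intro p
      simp only [noise, add_dotProduct, smul_dotProduct, smul_eq_mul]
      ring
    simp only [risk]
    simp_rw [e1]
    have i4 : Integrable (fun p => noise σ θ W p ^ 2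
        - 2 * s * (noise σ θ W p * (v ⬝ᵥ feature σ W p.1))) ρ := i1.sub (i2.const_mul _)
    rw [integral_add i4 (i3.const_mul _), integral_sub i1 (i2.const_mul _), integral_const_mul,
      integral_const_mul]
  have hmin : ∀ s : ℝ, 0 ≤ -2 * s * I + s ^ 2 * S := by
    intro s
    have h1 : risk σ ρ W (θ W) ≤ risk σ ρ W (θ W + s • v) :=
      isMinOn_iff.1 hθ _ (Set.mem_univ _)
    have h0 := hrisk 0
    simp only [zero_smul, add_zero] at h0
    rw [hrisk s, h0] at h1
    linarith
  have hS : 0 ≤ S := integral_nonneg fun _ => sq_nonneg _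
  -- The risk along the line is a quadratic in `s` with minimum at `0`, which forces its slope to
  -- vanish. The denominator `S + 1` in place of `S` also covers `S = 0`.
  have h1 := hmin (I / (S + 1))
  have e2 : -2 * (I / (S + 1)) * I + (I / (S + 1)) ^ 2 * S
      = -(I ^ 2 * (S + 2) / (S + 1) ^ 2) := by
    field_simp
    ring
  rw [e2, neg_nonneg] at h1
  have h2 : I ^ 2 * (S + 2) ≤ 0 := by
    by_contra! h
    exact absurd h1 (not_le.2 (by positivity))
  nlinarith [sq_nonneg I, mul_nonneg (sq_nonneg I) hS]

theorem noiseModel (hσ : Continuous σ)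
    (hR : ∀ᵐ p ∂ρ, feature σ W p.1 ⬝ᵥ feature σ W p.1 ≤ R)
    (hy : MemLp (fun p : EuclideanSpace ℝ (Fin d) × ℝ => p.2) 2 ρ)
    (hθ : IsMinOn (risk σ ρ W) Set.univ (θ W))
    (hτ : Loewner (matrixExp ρ fun p => noise σ θ W p ^ 2 • featureOuter σ W p.1)
      (τ ^ 2 • featureCov σ ρ W)) :
    NoiseModel ρ (fun p => feature σ W p.1) (noise σ θ W) R τ where
  measurable_u := (measurable_feature hσ W).comp measurable_fst
  measurable_e := measurable_noise hσ
  bound := hR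
  memLp := memLp_noise hσ hR hy
  mean := integral_noise_mul hσ hR hy hθ
  second v := by
    have hi : ∀ i j, Integrable (fun p => (noise σ θ W p ^ 2 • featureOuter σ W p.1) i j) ρ := by
      intro i j
      have h1 : MemLp (fun p => noise σ θ W p * feature σ W p.1 i) 2 ρ :=
        (memLp_top_feature hσ hR i).mul (p := 2) (q := ∞) (r := 2) (memLp_noise hσ hR hy)
      have h2 : MemLp (fun p => noise σ θ W p * feature σ W p.1 j) 2 ρ :=
        (memLp_top_feature hσ hR j).mul (p := 2) (q := ∞) (r := 2) (memLp_noise hσ hR hy)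
      refine (h1.integrable_mul h2).congr (ae_of_all _ fun p => ?_)
      simp only [Pi.mul_apply, Matrix.smul_apply, featureOuter, Matrix.vecMulVec_apply, smul_eq_mul]
      ring
    have h := hτ.dotProduct_mulVec_nonneg v
    simp only [star_trivial, Matrix.sub_mulVec, dotProduct_sub, Matrix.smul_mulVec,
      dotProduct_smul, smul_eq_mul] at h
    rw [dotProduct_featureCov_mulVec hσ hR, dotProduct_matrixExp_mulVec hi] at h
    simp only [Matrix.smul_mulVec, dotProduct_smul, smul_eq_mul, featureOuter,
      dotProduct_vecMulVec_mulVec] at h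
    linarith

theorem varIterate_eq_sgdIterate (γ₀ ζ : ℝ) (z : ℕ → EuclideanSpace ℝ (Fin d) × ℝ) (t : ℕ) :
    varIterate σ θ γ₀ ζ W z t
      = sgdIterate (fun p => feature σ W p.1) (noise σ θ W) (stepSize γ₀ ζ) z t := by
  induction t with
  | zero => rfl
  | succ t ih =>
    simp only [varIterate, sgdIterate, sgdStep, ih, featureOuter, Matrix.sub_mulVec,
      Matrix.one_mulVec, Matrix.smul_mulVec, Matrix.vecMulVec_mulVec, op_smul_eq_smul]
    module

theorem stepSize_nonneg {γ₀ ζ : ℝ} (hγ₀ : 0 ≤ γ₀) (t : ℕ) : 0 ≤ stepSize γ₀ ζ t := by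
  unfold stepSize
  positivity

theorem stepSize_succ_le {γ₀ ζ : ℝ} (hγ₀ : 0 ≤ γ₀) (hζ : 0 ≤ ζ) (t : ℕ) :
    stepSize γ₀ ζ (t + 1) ≤ γ₀ := by
  unfold stepSize
  refine mul_le_of_le_one_right hγ₀ (Real.rpow_le_one_of_one_le_of_nonpos ?_ (by linarith))
  push_cast
  linarith [(Nat.cast_nonneg t : (0 : ℝ) ≤ t)]

/-- The variance for fixed weights. -/
theorem lintegral_varAverage_le (hσ : Continuous σ)
    (hM : NoiseModel ρ (fun p => feature σ W p.1) (noise σ θ W) R τ)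
    {γ₀ ζ : ℝ} (hγ₀ : 0 ≤ γ₀) (hζ : 0 ≤ ζ) {n : ℕ} (hn : 0 < n) :
    ∫⁻ z, ENNReal.ofReal
        (varAverage σ θ γ₀ ζ n W z ⬝ᵥ (featureCov σ ρ W *ᵥ varAverage σ θ γ₀ ζ n W z))
      ∂(Measure.infinitePi fun _ : ℕ => ρ)
      ≤ ENNReal.ofReal (γ₀ * τ ^ 2 * R *
          (if γ₀ * R ≤ 1 then 1 else Real.exp (2 * n * (γ₀ * R)))) := by
  have hR := hM.nonneg
  -- The quadratic form of `Σ_m` is the mean squared prediction at a fresh sample point.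
  have e1 : ∀ z, ENNReal.ofReal
        (varAverage σ θ γ₀ ζ n W z ⬝ᵥ (featureCov σ ρ W *ᵥ varAverage σ θ γ₀ ζ n W z))
      = ∫⁻ p, ENNReal.ofReal ((((1 / (n : ℝ)) • ∑ t ∈ Finset.range n,
        sgdIterate (fun p => feature σ W p.1) (noise σ θ W) (stepSize γ₀ ζ) z t)
          ⬝ᵥ feature σ W p.1) ^ 2) ∂ρ := by
    intro z
    rw [dotProduct_featureCov_mulVec hσ hM.bound, ofReal_integral_eq_lintegral_ofReal
      (hM.integrable_sq_dotProduct _) (ae_of_all _ fun _ => sq_nonneg _)]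
    simp only [varAverage, varIterate_eq_sgdIterate]
  simp_rw [e1]
  have h0 : ∀ t, 0 ≤ stepSize γ₀ ζ (t + 1) := fun t => stepSize_nonneg hγ₀ _
  have h1 : ∀ t, stepSize γ₀ ζ (t + 1) ≤ γ₀ := stepSize_succ_le hγ₀ hζ
  split_ifs with h
  · refine (lintegral_average_le hM (by positivity) hn fun t _ =>
      momentBound_sgdIterate_of_le_one hM hγ₀ h0 h1 h t).trans (le_of_eq ?_)
    rw [mul_one]
  · have hQ : 0 ≤ γ₀ * R := mul_nonneg hγ₀ hR
    refine (lintegral_average_le hM (α := γ₀ * τ ^ 2 * Real.exp (2 * n * (γ₀ * R)))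
      (by positivity) hn fun t ht => ?_).trans (le_of_eq ?_)
    · have hb := momentBound_sgdIterate_exp hM hγ₀ h0 h1 t
      refine ⟨hb.memLp, hb.mean, fun v => (hb.second v).trans ?_⟩
      refine mul_le_mul_of_nonneg_right (mul_le_mul_of_nonneg_left ?_ (by positivity))
        (dotProduct_self_nonneg' v)
      calc (1 + γ₀ * R) ^ (2 * t) ≤ Real.exp (γ₀ * R) ^ (2 * t) := by
            gcongr
            linarith [Real.add_one_le_exp (γ₀ * R)]
        _ = Real.exp (2 * t * (γ₀ * R)) := by
            rw [← Real.exp_nat_mul]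
            push_cast
            rfl
        _ ≤ Real.exp (2 * n * (γ₀ * R)) := by
            have : (t : ℝ) ≤ n := by exact_mod_cast ht.le
            gcongr
    · congr 1
      ring

end Conditional

/-! ### Lower bound for the trace of the expected feature covariance -/

theorem integrable_sq_of_lipschitzWith {σ : ℝ → ℝ} {L : ℝ≥0} (hσ : LipschitzWith L σ) (v : ℝ≥0) :
    Integrable (fun s => σ s ^ 2) (gaussianReal 0 v) := by
  have h1 : Integrable (fun s : ℝ => s ^ 2) (gaussianReal 0 v) :=
    (memLp_id_gaussianReal 2).integrable_sq
  refine ((integrable_const (2 * σ 0 ^ 2)).add (h1.const_mul (2 * (L : ℝ) ^ 2))).mono'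
    (hσ.continuous.measurable.pow_const 2).aestronglyMeasurable (ae_of_all _ fun s => ?_)
  rw [Real.norm_eq_abs, abs_of_nonneg (sq_nonneg _)]
  exact sq_le_of_lipschitzWith hσ s

/-- A nonzero activation has a second moment bounded below, uniformly over centered Gaussian laws
with variance in a compact subset of `(0, ∞)`. -/
theorem exists_le_integral_sq_gaussianReal {σ : ℝ → ℝ} {L : ℝ≥0} (hσ : LipschitzWith L σ)
    {s₀ : ℝ} (hs₀ : σ s₀ ≠ 0) {v₀ v₁ : ℝ} (hv₀ : 0 < v₀) (hv₁ : 0 < v₁) :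
    ∃ κ > 0, ∀ v : ℝ≥0, v₀ ≤ v → v ≤ v₁ → κ ≤ ∫ s, σ s ^ 2 ∂(gaussianReal 0 v) := by
  set δ := σ s₀ ^ 2 / 2 with hδ
  have hδ0 : 0 < δ := by positivity
  have hcont : Continuous fun s => σ s ^ 2 := hσ.continuous.pow 2
  obtain ⟨h, hh, hball⟩ := Metric.isOpen_iff.1 (isOpen_lt continuous_const hcont) s₀
    (show δ < σ s₀ ^ 2 by rw [hδ]; linarith [pow_pos (abs_pos.2 hs₀) 2, sq_abs (σ s₀)])
  -- A lower bound for all the densities on the ball around `s₀`: the normalization is smallest at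
  -- the variance `v₁`, the exponential at the variance `v₀` and the largest possible `|s|`.
  set D := (√(2 * Real.pi * v₁))⁻¹ * Real.exp (-(|s₀| + h) ^ 2 / (2 * v₀)) with hD
  have hD0 : 0 < D := by
    have := Real.pi_pos
    positivity
  refine ⟨δ * (D * (2 * h)), by positivity, fun v hv hv' => ?_⟩
  have hvpos : (0 : ℝ) < v := hv₀.trans_le hv
  have hv0 : v ≠ 0 := by
    rintro rfl
    simp at hvpos
  have hpdf : ∀ s ∈ Metric.ball s₀ h, D ≤ gaussianPDFReal 0 v s := by
    intro s hs
    rw [gaussianPDFReal, hD]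
    have h1 : |s| ≤ |s₀| + h := by
      have := Metric.mem_ball.1 hs
      rw [Real.dist_eq] at this
      linarith [abs_sub_abs_le_abs_sub s s₀]
    have h2 : s ^ 2 ≤ (|s₀| + h) ^ 2 := by
      rw [← sq_abs s]
      exact pow_le_pow_left₀ (abs_nonneg _) h1 2
    have h3 : s ^ 2 / (2 * v) ≤ (|s₀| + h) ^ 2 / (2 * v₀) := by gcongr
    have hp := Real.pi_pos
    rw [sub_zero]
    refine mul_le_mul ?_ (Real.exp_le_exp.2 ?_) (Real.exp_pos _).le (by positivity)
    · gcongr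
    · rw [neg_div, neg_div]
      exact neg_le_neg h3
  have hmeas : D * (2 * h) ≤ (gaussianReal 0 v).real (Metric.ball s₀ h) := by
    rw [measureReal_def, gaussianReal_apply 0 hv0]
    refine (ENNReal.ofReal_le_iff_le_toReal ?_).1 ?_
    · rw [← gaussianReal_apply 0 hv0]
      exact measure_ne_top _ _
    · calc ENNReal.ofReal (D * (2 * h))
          = ∫⁻ _ in Metric.ball s₀ h, ENNReal.ofReal D := by
            rw [setLIntegral_const, Real.volume_ball, ENNReal.ofReal_mul hD0.le]
        _ ≤ _ := setLIntegral_mono' Metric.isOpen_ball.measurableSet fun s hs =>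
            ENNReal.ofReal_le_ofReal (hpdf s hs)
  have hmarkov := mul_meas_ge_le_integral_of_nonneg (μ := gaussianReal 0 v)
    (ae_of_all _ fun s => sq_nonneg (σ s)) (integrable_sq_of_lipschitzWith hσ v) δ
  refine le_trans ?_ hmarkov
  refine mul_le_mul_of_nonneg_left (hmeas.trans ?_) hδ0.le
  exact measureReal_mono fun s hs => (show δ < σ s ^ 2 from hball hs).le

section Trace

variable {m d : ℕ} {σ : ℝ → ℝ} {L : ℝ≥0}

theorem integrable_norm_sq_weightOp (m d : ℕ) :
    Integrable (fun W => ‖weightOp W‖ ^ 2) (weightLaw m d) := by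
  have hm : Measurable fun W : Fin m → Fin d → ℝ => Real.exp (‖weightOp W‖ ^ 2 / 256) :=
    Real.measurable_exp.comp ((measurable_norm_weightOp.pow_const 2).div_const _)
  have h1 : Integrable (fun W => Real.exp (‖weightOp W‖ ^ 2 / 256)) (weightLaw m d) := by
    refine ⟨hm.aestronglyMeasurable, ?_⟩
    rw [hasFiniteIntegral_iff_ofReal (ae_of_all _ fun _ => (Real.exp_pos _).le)]
    refine (lintegral_exp_norm_weightOp m d).trans_lt ?_
    exact ENNReal.mul_lt_top (ENNReal.pow_lt_top (by simp)) (ENNReal.pow_lt_top (by simp))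
  refine (h1.const_mul 256).mono' (measurable_norm_weightOp.pow_const 2).aestronglyMeasurable
    (ae_of_all _ fun W => ?_)
  rw [Real.norm_eq_abs, abs_of_nonneg (sq_nonneg _)]
  linarith [Real.add_one_le_exp (‖weightOp W‖ ^ 2 / 256)]

/-- The preactivation `⟨W i, x⟩ / √d` is a centered Gaussian of variance `‖x‖² / d`. -/
theorem integral_feature_sq (hσ : Continuous σ) (hd : 0 < d) (x : EuclideanSpace ℝ (Fin d))
    (i : Fin m) :
    ∫ W, feature σ W x i ^ 2 ∂(weightLaw m d)
      = (∫ s, σ s ^ 2 ∂(gaussianReal 0 (‖x‖ ^ 2 / d).toNNReal)) / m := by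
  have hd' : (0 : ℝ) < d := by exact_mod_cast hd
  have e1 : ‖x‖ ^ 2 / d = ‖(√(d : ℝ))⁻¹ • x‖ ^ 2 := by
    rw [norm_smul, mul_pow, Real.norm_eq_abs, sq_abs, inv_pow, Real.sq_sqrt hd'.le]
    ring
  have hmeas := hσ.measurable
  rw [e1, ← map_weightLaw_row (m := m) i, integral_map (Measurable.aemeasurable (by fun_prop))
    (hmeas.pow_const 2).aestronglyMeasurable, ← integral_div]
  refine integral_congr_ae (ae_of_all _ fun W => ?_)
  simp only [feature, div_pow, Real.sq_sqrt (Nat.cast_nonneg m), PiLp.smul_apply, smul_eq_mul]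
  congr 3
  rw [div_eq_inv_mul, Finset.mul_sum]
  refine Finset.sum_congr rfl fun j _ => ?_
  ring

variable {ρ : Measure (EuclideanSpace ℝ (Fin d) × ℝ)} [IsProbabilityMeasure ρ] {B : ℝ}

theorem integrable_feature_sq (hσ : LipschitzWith L σ) (hm : 0 < m) (hd : 0 < d)
    (hB : ∀ᵐ p ∂ρ, ‖p.1‖ ^ 2 ≤ B * d) (i : Fin m) :
    Integrable (fun q : (Fin m → Fin d → ℝ) × (EuclideanSpace ℝ (Fin d) × ℝ) =>
      feature σ q.1 q.2.1 i ^ 2) ((weightLaw m d).prod ρ) := by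
  have h1 : Integrable (fun W => 2 * σ 0 ^ 2 + 2 * (L : ℝ) ^ 2 * B * (‖weightOp W‖ ^ 2 / m))
      (weightLaw m d) :=
    (integrable_const _).add (((integrable_norm_sq_weightOp m d).div_const _).const_mul _)
  have hmeas : Measurable fun q : (Fin m → Fin d → ℝ) × (EuclideanSpace ℝ (Fin d) × ℝ) =>
      feature σ q.1 q.2.1 i ^ 2 :=
    ((measurable_pi_apply i).comp ((measurable_feature_uncurry hσ.continuous).comp
      (measurable_fst.prodMk (measurable_fst.comp measurable_snd)))).pow_const 2
  refine (h1.comp_fst ρ).mono' hmeas.aestronglyMeasurable ?_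
  have h2 : ∀ᵐ q ∂((weightLaw m d).prod ρ), ‖q.2.1‖ ^ 2 ≤ B * d :=
    Measure.quasiMeasurePreserving_snd.ae hB
  filter_upwards [h2] with q hq
  rw [Real.norm_eq_abs, abs_of_nonneg (sq_nonneg _)]
  exact (sq_apply_le_dotProduct_self _ i).trans (feature_dotProduct_self_le hσ hm hd q.1 hq)

theorem integrable_norm_sq (hB : ∀ᵐ p ∂ρ, ‖p.1‖ ^ 2 ≤ B * d) :
    Integrable (fun p => ‖p.1‖ ^ 2) ρ := by
  refine (integrable_const (B * d)).mono' (by fun_prop) ?_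
  filter_upwards [hB] with p hp
  rwa [Real.norm_eq_abs, abs_of_nonneg (sq_nonneg _)]

theorem trace_dataCov (hB : ∀ᵐ p ∂ρ, ‖p.1‖ ^ 2 ≤ B * d) :
    (dataCov ρ).trace = ∫ p, ‖p.1‖ ^ 2 ∂ρ := by
  have h1 : ∀ i, Integrable (fun p : EuclideanSpace ℝ (Fin d) × ℝ => p.1 i * p.1 i) ρ := by
    intro i
    refine (integrable_norm_sq hB).mono' (by fun_prop) (ae_of_all _ fun p => ?_)
    rw [Real.norm_eq_abs, abs_of_nonneg (mul_self_nonneg _), EuclideanSpace.real_norm_sq_eq,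
      ← pow_two]
    exact Finset.single_le_sum (f := fun i => p.1 i ^ 2) (fun i _ => sq_nonneg _)
      (Finset.mem_univ i)
  simp only [Matrix.trace, Matrix.diag, dataCov, matrixExp, Matrix.of_apply, Matrix.vecMulVec_apply]
  rw [← integral_finsetSum _ fun i _ => h1 i]
  simp_rw [EuclideanSpace.real_norm_sq_eq, pow_two]

/-- The trace of the expected feature covariance is bounded below. -/
theorem le_trace_meanFeatureCov (hσ : LipschitzWith L σ) (hm : 0 < m) (hd : 0 < d) {a κ : ℝ}
    (ha : 0 ≤ a) (hB0 : 0 < B) (hκ : 0 < κ)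
    (hlow : ∀ v : ℝ≥0, a / 2 ≤ v → v ≤ B → κ ≤ ∫ s, σ s ^ 2 ∂(gaussianReal 0 v))
    (hB : ∀ᵐ p ∂ρ, ‖p.1‖ ^ 2 ≤ B * d) (hA : a * d ≤ (dataCov ρ).trace) :
    κ * (a / 2) / B ≤ (meanFeatureCov σ m ρ).trace := by
  have hm' : (0 : ℝ) < m := by exact_mod_cast hm
  have hd' : (0 : ℝ) < d := by exact_mod_cast hd
  have hrow : ∀ i : Fin m, κ * (a / 2) / B / m
      ≤ ∫ W, ∫ p, feature σ W p.1 i ^ 2 ∂ρ ∂(weightLaw m d) := by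
    intro i
    have hint := integrable_feature_sq hσ hm hd hB i
    rw [integral_integral_swap hint]
    -- A minorant affine in `‖x‖² / d`: it is nonpositive below `a / 2`, and above `a / 2` it is at
    -- most `κ / m` since `‖x‖² / d ≤ B`. Being affine, it integrates using only the mean of `‖x‖² /
    -- d`, which is at least `a`.
    have h1 : ∀ᵐ p ∂ρ, κ / B / m * (‖p.1‖ ^ 2 / d - a / 2)
        ≤ ∫ W, feature σ W p.1 i ^ 2 ∂(weightLaw m d) := by
      filter_upwards [hB] with p hp
      have hxB : ‖p.1‖ ^ 2 / d ≤ B := (div_le_iff₀ hd').2 hp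
      have hx0 : 0 ≤ ‖p.1‖ ^ 2 / d := by positivity
      rcases le_total (a / 2) (‖p.1‖ ^ 2 / d) with h | h
      · rw [integral_feature_sq hσ.continuous hd]
        have h2 := hlow (‖p.1‖ ^ 2 / d).toNNReal (by rwa [Real.coe_toNNReal _ hx0])
          (by rwa [Real.coe_toNNReal _ hx0])
        refine (mul_le_mul_of_nonneg_left (show ‖p.1‖ ^ 2 / d - a / 2 ≤ B by linarith)
          (by positivity)).trans ?_
        calc κ / B / m * B = κ / m := by field_simp
          _ ≤ _ := by gcongr
      · refine le_trans ?_ (integral_nonneg fun _ => sq_nonneg _)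
        exact mul_nonpos_of_nonneg_of_nonpos (by positivity) (by linarith)
    have i1 : Integrable (fun p : EuclideanSpace ℝ (Fin d) × ℝ =>
        κ / B / m * (‖p.1‖ ^ 2 / d - a / 2)) ρ :=
      (((integrable_norm_sq hB).div_const _).sub (integrable_const _)).const_mul _
    refine le_trans ?_ (integral_mono_ae i1 hint.integral_prod_right h1)
    rw [integral_const_mul, integral_sub ((integrable_norm_sq hB).div_const _)
      (integrable_const _), integral_div, ← trace_dataCov hB]
    have h2 : a ≤ (dataCov ρ).trace / d := (le_div_iff₀ hd').2 hA
    have h3 : κ * (a / 2) / B / m = κ / B / m * (a / 2) := by ring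
    rw [h3]
    refine mul_le_mul_of_nonneg_left ?_ (by positivity)
    simp only [integral_const, probReal_univ, smul_eq_mul, one_mul]
    linarith
  have e1 : (meanFeatureCov σ m ρ).trace
      = ∑ i, ∫ W, ∫ p, feature σ W p.1 i ^ 2 ∂ρ ∂(weightLaw m d) := by
    simp only [Matrix.trace, Matrix.diag, meanFeatureCov, featureCov, matrixExp, Matrix.of_apply,
      featureOuter, Matrix.vecMulVec_apply, ← pow_two]
  rw [e1]
  calc κ * (a / 2) / B = ∑ _i : Fin m, κ * (a / 2) / B / m := by
        simp only [Finset.sum_const, Finset.card_univ, Fintype.card_fin, nsmul_eq_mul]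
        field_simp
    _ ≤ _ := Finset.sum_le_sum fun i _ => hrow i

end Trace

/-! ### Integration over the weights -/

/-- For `γ₀ R ≤ 1`, `x + 1 ≤ exp x` suffices. For `γ₀ R > 1`, half of the exponent `lam n R`
dominates the factor `R`; the other half pays for `2 n γ₀ R` and for `M n`, the latter because `M n
≤ M n γ₀ R`. -/
theorem mul_ite_exp_le {γ₀ R lam M : ℝ} {n : ℕ} (hn : 0 < n) (hR : 0 ≤ R)
    (hlam : 0 < lam) (hM : 0 ≤ M) (hγ : (2 + M) * γ₀ ≤ lam / 2) :
    R * (if γ₀ * R ≤ 1 then 1 else Real.exp (2 * n * (γ₀ * R)))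
      ≤ 1 / lam * (M + 2 * Real.exp (lam * n * R - M * n)) := by
  have hn' : (1 : ℝ) ≤ n := by exact_mod_cast hn
  have hE := Real.exp_pos (lam * n * R - M * n)
  rw [one_div, ← div_eq_inv_mul, le_div_iff₀ hlam]
  split_ifs with h
  · have h1 := Real.add_one_le_exp (lam * n * R - M * n)
    have h2 : n * (lam * R - M) ≤ n * Real.exp (lam * n * R - M * n) := by
      have : Real.exp (lam * n * R - M * n) ≤ n * Real.exp (lam * n * R - M * n) :=
        le_mul_of_one_le_left hE.le hn'
      linarith
    have h3 := le_of_mul_le_mul_left h2 (by linarith)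
    linarith
  · push Not at h
    have h1 : Real.exp (2 * n * (γ₀ * R)) ≤ Real.exp (lam * n * R / 2 - M * n) := by
      refine Real.exp_le_exp.2 ?_
      have h2 : 0 ≤ M * n * (γ₀ * R - 1) := mul_nonneg (by positivity) (by linarith)
      have h3 := mul_le_mul_of_nonneg_left hγ (by positivity : 0 ≤ n * R)
      linarith
    have h2 : R * lam ≤ 2 * Real.exp (lam * n * R / 2) := by
      have h3 := Real.add_one_le_exp (lam * n * R / 2)
      have h4 : R * lam ≤ n * (R * lam) := le_mul_of_one_le_left (by positivity) hn'
      linarith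
    calc R * Real.exp (2 * n * (γ₀ * R)) * lam
        = R * lam * Real.exp (2 * n * (γ₀ * R)) := by ring
      _ ≤ 2 * Real.exp (lam * n * R / 2) * Real.exp (lam * n * R / 2 - M * n) :=
          mul_le_mul h2 h1 (Real.exp_pos _).le (by positivity)
      _ = 2 * Real.exp (lam * n * R - M * n) := by
          rw [mul_assoc, ← Real.exp_add]
          congr 2
          ring
      _ ≤ _ := by linarith

/-- Comparability gives `n / m ≤ 1 / c`, which brings the coefficient of `‖W‖²` below `1 / 256`. The
shift `4 * C * n` then cancels `8 ^ d * 2 ^ m = 2 ^ (3 d + m) ≤ exp (4 C n)`. -/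
theorem lintegral_exp_le_one {m d n : ℕ} (hn : 0 < n) (hm : 0 < m) {c C A D lam : ℝ} (hc : 0 < c)
    (hcm : c ≤ (m : ℝ) / n) (hCm : (m : ℝ) / n ≤ C) (hCd : (d : ℝ) / n ≤ C)
    (hD : 0 ≤ D) (hlam : 0 ≤ lam) (hlamD : lam * (D / c) ≤ 1 / 256) :
    ∫⁻ W, ENNReal.ofReal (Real.exp (lam * n * (A + D * (‖weightOp W‖ ^ 2 / m))
      - (lam * A + 4 * C) * n)) ∂(weightLaw m d) ≤ 1 := by
  have hn' : (0 : ℝ) < n := by exact_mod_cast hn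
  have hm' : (0 : ℝ) < m := by exact_mod_cast hm
  have h1 : ∀ W : Fin m → Fin d → ℝ,
      ENNReal.ofReal (Real.exp (lam * n * (A + D * (‖weightOp W‖ ^ 2 / m))
        - (lam * A + 4 * C) * n))
      ≤ ENNReal.ofReal (Real.exp (-(4 * C * n)))
        * ENNReal.ofReal (Real.exp (‖weightOp W‖ ^ 2 / 256)) := by
    intro W
    rw [← ENNReal.ofReal_mul (Real.exp_pos _).le, ← Real.exp_add]
    refine ENNReal.ofReal_le_ofReal (Real.exp_le_exp.2 ?_)
    have h2 : n / (m : ℝ) ≤ 1 / c := by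
      rw [div_le_div_iff₀ hm' hc]
      have := (le_div_iff₀ hn').1 hcm
      linarith
    have h3 : lam * D * (n / m) ≤ 1 / 256 := by
      refine (mul_le_mul_of_nonneg_left h2 (mul_nonneg hlam hD)).trans ?_
      calc lam * D * (1 / c) = lam * (D / c) := by ring
        _ ≤ _ := hlamD
    have h4 := mul_le_mul_of_nonneg_right h3 (sq_nonneg ‖weightOp W‖)
    have h5 : lam * n * (A + D * (‖weightOp W‖ ^ 2 / m)) - (lam * A + 4 * C) * n
        = lam * D * (n / m) * ‖weightOp W‖ ^ 2 - 4 * C * n := by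
      field_simp
      ring
    rw [h5]
    linarith
  refine (lintegral_mono h1).trans ?_
  rw [lintegral_const_mul' _ _ ENNReal.ofReal_ne_top]
  refine (mul_le_mul_right (lintegral_exp_norm_weightOp m d) _).trans ?_
  have h2 : (8 : ℝ≥0∞) ^ d * 2 ^ m ≤ ENNReal.ofReal (Real.exp (4 * C * n)) := by
    have h3 : (8 : ℝ≥0∞) ^ d * 2 ^ m = ENNReal.ofReal ((2 : ℝ) ^ (3 * d + m)) := by
      rw [ENNReal.ofReal_pow (by norm_num), ENNReal.ofReal_ofNat, pow_add, pow_mul]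
      norm_num
    rw [h3]
    refine ENNReal.ofReal_le_ofReal ?_
    have h4 : (2 : ℝ) ≤ Real.exp 1 := by linarith [Real.add_one_le_exp (1 : ℝ)]
    refine (pow_le_pow_left₀ (by norm_num) h4 _).trans ?_
    rw [← Real.exp_nat_mul]
    refine Real.exp_le_exp.2 ?_
    have h5 := (div_le_iff₀ hn').1 hCm
    have h6 := (div_le_iff₀ hn').1 hCd
    push_cast
    linarith
  refine (mul_le_mul_right h2 _).trans ?_
  rw [← ENNReal.ofReal_mul (Real.exp_pos _).le, ← Real.exp_add]
  simp

/-- The degenerate activation is treated apart: its feature covariance vanishes, so the step size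
condition does not restrict `γ₀`. -/
theorem variance_eq_zero {σ : ℝ → ℝ} (hσ : ∀ s, σ s = 0) {m d : ℕ}
    (ρ : Measure (EuclideanSpace ℝ (Fin d) × ℝ)) [IsProbabilityMeasure ρ]
    (θ : (Fin m → Fin d → ℝ) → Fin m → ℝ) (γ₀ ζ : ℝ) (n : ℕ) :
    variance σ ρ θ γ₀ ζ n = 0 := by
  have h1 : ∀ W : Fin m → Fin d → ℝ, featureCov σ ρ W = 0 := by
    intro W
    ext i j
    simp [featureCov, matrixExp, featureOuter, feature, hσ, Matrix.vecMulVec_apply]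
  simp [variance, h1]

/-- The variance bound with explicit constants, in terms of a bound on the step size. Where
`γ₀ ‖φ(x)‖²` may exceed `1` the iterates can grow exponentially, but for comparable `n`, `m`, `d`
the Gaussian tail of the operator norm of `W` compensates this. -/
theorem variance_le {σ : ℝ → ℝ} {L : ℝ≥0} (hσ : LipschitzWith L σ) {c C B lam : ℝ} (hc : 0 < c)
    (hB0 : 0 ≤ B) (hlam : 0 < lam) (hlamD : lam * (2 * L ^ 2 * B / c) ≤ 1 / 256)
    {n m d : ℕ} (hn : 0 < n) (hm : 0 < m) (hd : 0 < d) (hcm : c ≤ (m : ℝ) / n)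
    (hCm : (m : ℝ) / n ≤ C) (hCd : (d : ℝ) / n ≤ C)
    {ρ : Measure (EuclideanSpace ℝ (Fin d) × ℝ)} [IsProbabilityMeasure ρ]
    (hB : ∀ᵐ p ∂ρ, ‖p.1‖ ^ 2 ≤ B * d)
    (hy : MemLp (fun p : EuclideanSpace ℝ (Fin d) × ℝ => p.2) 2 ρ)
    {θ : (Fin m → Fin d → ℝ) → Fin m → ℝ} (hθ : IsTarget σ ρ θ) {τ : ℝ}
    (hτ : NoiseCondition σ ρ θ τ) {γ₀ ζ : ℝ} (hγ₀ : 0 ≤ γ₀) (hζ : 0 ≤ ζ)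
    (hγ : (2 + (lam * (2 * σ 0 ^ 2) + 4 * C)) * γ₀ ≤ lam / 2) :
    variance σ ρ θ γ₀ ζ n
      ≤ ENNReal.ofReal (γ₀ * τ ^ 2 * (1 / lam * (lam * (2 * σ 0 ^ 2) + 4 * C + 2))) := by
  have hC : 0 ≤ C := hc.le.trans (hcm.trans hCm)
  set A := 2 * σ 0 ^ 2 with hA
  set D := 2 * (L : ℝ) ^ 2 * B with hD
  set M := lam * A + 4 * C with hMdef
  have hA0 : 0 ≤ A := by positivity
  have hD0 : 0 ≤ D := by positivity
  have hM : 0 ≤ M := by positivity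
  set E := fun W : Fin m → Fin d → ℝ =>
    Real.exp (lam * n * (A + D * (‖weightOp W‖ ^ 2 / m)) - M * n) with hE
  have hEint : ∫⁻ W, ENNReal.ofReal (E W) ∂(weightLaw m d) ≤ 1 :=
    lintegral_exp_le_one hn hm hc hcm hCm hCd hD0 hlam.le hlamD
  have hW : ∀ᵐ W ∂(weightLaw m d), ∫⁻ z, ENNReal.ofReal
        (varAverage σ θ γ₀ ζ n W z ⬝ᵥ (featureCov σ ρ W *ᵥ varAverage σ θ γ₀ ζ n W z))
      ∂(Measure.infinitePi fun _ : ℕ => ρ)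
      ≤ ENNReal.ofReal (γ₀ * τ ^ 2 * (1 / lam)) *
          (ENNReal.ofReal M + ENNReal.ofReal 2 * ENNReal.ofReal (E W)) := by
    filter_upwards [hτ] with W hτW
    have hbound : ∀ᵐ p ∂ρ, feature σ W p.1 ⬝ᵥ feature σ W p.1
        ≤ A + D * (‖weightOp W‖ ^ 2 / m) := by
      filter_upwards [hB] with p hp
      exact feature_dotProduct_self_le hσ hm hd W hp
    have hmodel := noiseModel hσ.continuous hbound hy (hθ.minimizes W) hτW
    refine (lintegral_varAverage_le hσ.continuous hmodel hγ₀ hζ hn).trans ?_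
    rw [← ENNReal.ofReal_mul zero_le_two, ← ENNReal.ofReal_add hM (by positivity),
      ← ENNReal.ofReal_mul (by positivity)]
    refine ENNReal.ofReal_le_ofReal ?_
    rw [mul_assoc, mul_assoc (γ₀ * τ ^ 2)]
    exact mul_le_mul_of_nonneg_left (mul_ite_exp_le hn hmodel.nonneg hlam hM hγ) (by positivity)
  refine (lintegral_mono_ae hW).trans ?_
  rw [lintegral_const_mul' _ _ ENNReal.ofReal_ne_top, lintegral_add_left measurable_const,
    lintegral_const_mul' _ _ (by simp), lintegral_const, measure_univ, mul_one,
    ← mul_assoc (γ₀ * τ ^ 2), ENNReal.ofReal_mul (p := γ₀ * τ ^ 2 * (1 / lam)) (by positivity),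
    ENNReal.ofReal_add hM zero_le_two]
  gcongr
  exact (mul_le_mul_right hEint _).trans_eq (mul_one _)

/-! ### The rate as a function of `m` -/

/-- For `m ≤ n` the rate equals `(m / n) * n ^ ζ ≥ c`; otherwise its first term is already `1`. -/
theorem le_varianceRate {c ζ : ℝ} (hζ : 0 ≤ ζ) {n m : ℕ} (hn : 0 < n)
    (hcm : c ≤ (m : ℝ) / n) : min c 1 ≤ varianceRate ζ n m := by
  have hn' : (0 : ℝ) < n := by exact_mod_cast hn
  have hn1 : (1 : ℝ) ≤ n := by exact_mod_cast hn
  unfold varianceRate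
  split_ifs with h
  · refine (min_le_left _ _).trans ?_
    have h1 := (le_div_iff₀ hn').1 hcm
    have h2 : (n : ℝ) ^ (ζ - 1) = (n : ℝ) ^ ζ / n := Real.rpow_sub_one hn'.ne' ζ
    have h3 : 1 ≤ (n : ℝ) ^ ζ := Real.one_le_rpow hn1 hζ
    rw [h2, ← mul_div_assoc, le_div_iff₀ hn']
    refine h1.trans (le_mul_of_one_le_right (Nat.cast_nonneg m) h3)
  · refine (min_le_right _ _).trans ?_
    have : 0 ≤ (n : ℝ) ^ (ζ - 1) := by positivity
    have : 0 ≤ (n : ℝ) / m := by positivity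
    linarith

theorem strictMonoOn_varianceRate (ζ : ℝ) {n : ℕ} (hn : 0 < n) :
    StrictMonoOn (fun m : ℕ => varianceRate ζ n m) (Set.Iic n) := by
  intro k hk l hl hkl
  have hn' : (0 : ℝ) < n := by exact_mod_cast hn
  simp only [varianceRate, if_pos (Set.mem_Iic.1 hk), if_pos (Set.mem_Iic.1 hl)]
  exact mul_lt_mul_of_pos_right (by exact_mod_cast hkl) (by positivity)

theorem strictAntiOn_varianceRate (ζ : ℝ) {n : ℕ} (hn : 0 < n) :
    StrictAntiOn (fun m : ℕ => varianceRate ζ n m) (Set.Ioi n) := by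
  intro k hk l hl hkl
  have hn' : (0 : ℝ) < n := by exact_mod_cast hn
  have hk0 : (0 : ℝ) < k := by exact_mod_cast hn.trans (Set.mem_Ioi.1 hk)
  have hkl' : (k : ℝ) < l := by exact_mod_cast hkl
  simp only [varianceRate, if_neg (not_le.2 (Set.mem_Ioi.1 hk)),
    if_neg (not_le.2 (Set.mem_Ioi.1 hl))]
  have := div_lt_div_of_pos_left hn' hk0 hkl'
  linarith

end RFSGD
end

/-! ### Choice of constants and conclusion -/

theorem theorem2 (σ : ℝ → ℝ) (hσ : ∃ L : ℝ≥0, LipschitzWith L σ)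
    (c C a b s : ℝ) (hc : 0 < c) (ha : 0 < a) :
    (∃ c₀ > 0, ∃ C₀ > 0, ∀ ζ : ℝ, 0 ≤ ζ → ζ < 1 →
      ∀ n m d : ℕ, RFSGD.Comparable c C n m d →
      ∀ (ρ : Measure (EuclideanSpace ℝ (Fin d) × ℝ)) [IsProbabilityMeasure ρ],
        RFSGD.DataCondition a b s ρ →
      ∀ r' r : ℝ, 1 ≤ r' → 1 ≤ r → RFSGD.FourthMoment σ m ρ r' r →
      ∀ θ : (Fin m → Fin d → ℝ) → Fin m → ℝ, RFSGD.IsTarget σ ρ θ →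
      ∀ τ : ℝ, 0 < τ → RFSGD.NoiseCondition σ ρ θ τ →
      ∀ γ₀ : ℝ, 0 < γ₀ → γ₀ * (r' * (RFSGD.meanFeatureCov σ m ρ).trace) ≤ c₀ →
        RFSGD.variance σ ρ θ γ₀ ζ n ≤
          ENNReal.ofReal (C₀ * (γ₀ * r' * τ ^ 2 * RFSGD.varianceRate ζ n m))) ∧
    (∀ ζ : ℝ, 0 ≤ ζ → ζ < 1 → ∀ n : ℕ, 0 < n →
      StrictMonoOn (fun m : ℕ => RFSGD.varianceRate ζ n m) (Set.Iic n) ∧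
      StrictAntiOn (fun m : ℕ => RFSGD.varianceRate ζ n m) (Set.Ioi n)) := by
  refine ⟨?_, fun ζ _ _ n hn =>
    ⟨RFSGD.strictMonoOn_varianceRate ζ hn, RFSGD.strictAntiOn_varianceRate ζ hn⟩⟩
  obtain ⟨L, hL⟩ := hσ
  by_cases hσ0 : ∀ t, σ t = 0
  · refine ⟨1, one_pos, 1, one_pos, ?_⟩
    intros
    rw [RFSGD.variance_eq_zero hσ0]
    exact zero_le
  push Not at hσ0
  obtain ⟨s₀, hs₀⟩ := hσ0
  -- The signs of `b` and `C` are not known when the constants are chosen, so `|b| + 1` and, below,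
  -- `|C|` are used.
  set B := |b| + 1 with hBdef
  have hB0 : 0 < B := by positivity
  obtain ⟨κ, hκ, hlow⟩ := RFSGD.exists_le_integral_sq_gaussianReal hL hs₀ (half_pos ha) hB0
  set D := 2 * (L : ℝ) ^ 2 * B / c with hD
  have hD0 : 0 ≤ D := by positivity
  -- This makes `lam * D ≤ 1 / 256`; the summand `1` covers `D = 0`, which occurs for `L = 0`.
  set lam := 1 / (256 * (D + 1)) with hlamdef
  have hlam : 0 < lam := by positivity
  have hlamD : lam * D ≤ 1 / 256 := by
    rw [hlamdef, div_mul_eq_mul_div, one_mul, div_le_div_iff₀ (by positivity) (by norm_num)]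
    linarith
  set M := lam * (2 * σ 0 ^ 2) + 4 * |C| with hM
  have hM0 : 0 ≤ M := by positivity
  set κ' := κ * (a / 2) / B with hκ'
  have hκ'0 : 0 < κ' := by positivity
  have hmin : 0 < min c 1 := lt_min hc one_pos
  -- As the trace is at least `κ'` and `r' ≥ 1`, this `c₀` forces `γ₀ ≤ lam / (2 (2 + M))`, the
  -- smallness needed by `variance_le`. Dividing by `min c 1` in `C₀` brings in the rate.
  refine ⟨κ' * (lam / (2 * (2 + M))), by positivity, 1 / lam * (M + 2) / min c 1, by positivity, ?_⟩
  intro ζ hζ _ n m d hcomp ρ _ hdata r' r hr' _ _ θ hθ τ hτ0 hτ γ₀ hγ₀ hstep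
  have hn := hcomp.n_pos
  have hn' : (0 : ℝ) < n := by exact_mod_cast hn
  have hm : 0 < m := by
    have := hc.trans_le hcomp.m_lower
    by_contra! h
    simp [Nat.le_zero.1 h] at this
  have hd : 0 < d := by
    have := hc.trans_le hcomp.d_lower
    by_contra! h
    simp [Nat.le_zero.1 h] at this
  have hC : |C| = C := abs_of_nonneg (hc.le.trans (hcomp.m_lower.trans hcomp.m_upper))
  have hB : ∀ᵐ p ∂ρ, ‖p.1‖ ^ 2 ≤ B * d := by
    filter_upwards [hdata.norm_upper] with p hp
    refine hp.trans (mul_le_mul_of_nonneg_right ?_ (Nat.cast_nonneg d))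
    linarith [le_abs_self b]
  have htr := RFSGD.le_trace_meanFeatureCov hL hm hd ha.le hB0 hκ hlow hB hdata.norm_lower
  have hγ : (2 + M) * γ₀ ≤ lam / 2 := by
    have h1 : γ₀ * κ' ≤ κ' * (lam / (2 * (2 + M))) := by
      refine le_trans ?_ hstep
      refine mul_le_mul_of_nonneg_left ?_ hγ₀.le
      exact htr.trans (le_mul_of_one_le_left (hκ'0.le.trans htr) hr')
    rw [mul_comm γ₀] at h1
    have h2 := le_of_mul_le_mul_left h1 hκ'0
    rw [le_div_iff₀ (by positivity)] at h2
    linarith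
  have hrate := RFSGD.le_varianceRate hζ hn hcomp.m_lower
  rw [hC] at hM
  refine (RFSGD.variance_le hL hc hB0.le hlam hlamD hn hm hd hcomp.m_lower hcomp.m_upper
    hcomp.d_upper hB hdata.label hθ hτ hγ₀.le hζ (by rwa [← hM])).trans ?_
  refine ENNReal.ofReal_le_ofReal ?_
  rw [← hM]
  have h1 : γ₀ * τ ^ 2 * (1 / lam * (M + 2))
      = 1 / lam * (M + 2) / min c 1 * (γ₀ * 1 * τ ^ 2 * min c 1) := by
    field_simp
  rw [h1]
  have hr0 : 0 ≤ r' := by linarith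
  gcongr
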